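/- Let $p,q\in L_2(0,\pi)$ be real-valued, $a\in[0,\pi]$, $0<\alpha\neq 1$, $h_1\in\mathbb R$, $h_2>0$, and let $\rho(x)=1$ for $0\le x\le a$, $\rho(x)=\alpha$ for $a<x\le\pi$. Consider the boundary value problem $$By'+\Omega(x)y=\lambda\rho(x)y\quad(0<x<\pi),\qquad y_1(0)=0,\qquad (\lambda+h_1)y_1(\pi)+h_2y_2(\pi)=0,$$ $$B=\begin{pmatrix}0&1\\-1&0\end{pmatrix},\qquad \Omega=\begin{pmatrix}p&q\\q&-p\end{pmatrix},\qquad y=\begin{pmatrix}y_1\\y_2\end{pmatrix},$$ where $\lambda\in\mathbb C$ and solutions are absolutely continuous on $[0,\pi]$. In the Hilbert space $H=L_{2,\rho}(0,\pi;\mathbb C^2)\oplus\mathbb C$ with $$\langle Y,Z\rangle=\int_0^\pi (y_1\overline{z}_1+y_2\overline{z}_2)\rho\,dx+\frac1{h_2}y_3\overline{z}_3 ,$$ let $D(L)$ be the set of all $Y=(y_1,y_2,y_3)\in H$ with $y_1,y_2\in AC[0,\pi]$, $y_1(0)=0$, $y_3=y_1(\pi)$ and $l(y):=\rho^{-1}(By'+\Omega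 y)\in L_{2,\rho}(0,\pi;\mathbb C^2)$. Let $\varphi(x,\lambda)$ be the solution of the differential equation with $\varphi(0,\lambda)=(0,-1)^T$. The eigenvalues are real and can be listed, each once, as $(\lambda_n)_{n\in\mathbb Z}$. For any such listing put $\Phi_n=(\varphi(\cdot,\lambda_n),\varphi_1(\pi,\lambda_n))\in H$, $\alpha_n=\|\Phi_n\|_H^2$, and, for $F\in H$, $a_n=\frac1{\alpha_n}\langle F,\Phi_n\rangle$. Then: a) The eigenfunctions $\varphi(x,\lambda_n)$, $n\in\mathbb Z$, form a complete system in $L_{2,\rho}(0,\pi;\mathbb C^2)$, i.e. their linear span is dense. b) If $F=(f,f_1(\pi))\in D(L)$, then $f(x)=\sum_{n\in\mathbb Z}a_n\varphi(x,\lambda_n)$, and the series converges (unconditionally) uniformly in $x\in[0,\pi]$. For every $F=(f,c)\in H$, in particular for $f\in L_{2,\rho}(0,\pi;\mathbb C^2)$, regarded as $F=(f,0)$, the series $\sum_{n\in\mathbb Z} a_n\varphi(\cdot,\lambda_n)$ converges (unconditionally) to $f$ in $L_{2,\rho}(0,\pi;\mathbb C^2)$, and the Parseval equality $\|F\|_H^2=\sum_{n\in\mathbb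 Z}\alpha_n|a_n|^2$ holds; for $F=(f,0)$ the left-hand side is $\|f\|^2_{L_{2,\rho}}$. -/

import Mathlib

open MeasureTheory Filter Topology
open scoped Real ENNReal ComplexConjugate

noncomputable section

/-- Values of two-component functions. -/
abbrev Vec2 : Type := EuclideanSpace ℂ (Fin 2)

/-- The data of the boundary value problem
`B y' + Ω y = z ρ y` on `(0, π)`, `y₁(0) = 0`, `(z + h₁) y₁(π) + h₂ y₂(π) = 0`,
where `B = (0 1; -1 0)`, `Ω = (p q; q -p)`, `p, q ∈ L₂(0, π)` are real-valued, and the weight is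
`ρ = 1` on `[0, a]`, `ρ = α` on `(a, π]`. -/
structure DiracProblem where
  (a α h₁ h₂ : ℝ)
  (p q : ℝ → ℝ)
  a_mem : a ∈ Set.Icc 0 π
  α_pos : 0 < α
  α_ne_one : α ≠ 1
  h₂_pos : 0 < h₂
  p_mem : MemLp p 2 (volume.restrict (Set.Ioo 0 π))
  q_mem : MemLp q 2 (volume.restrict (Set.Ioo 0 π))

namespace DiracProblem

variable (P : DiracProblem)

/-- The weight `ρ`. -/
def rho (x : ℝ) : ℝ := if x ≤ P.a then 1 else P.α

/-- The measure `ρ(x) dx` on `(0, π)`; thus `f ∈ L_{2,ρ}(0, π; ℂ²)` is `MemLp f 2 P.wMeasure`. -/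
def wMeasure : Measure ℝ :=
  (volume.restrict (Set.Ioo 0 π)).withDensity (fun x => ENNReal.ofReal (P.rho x))

/-- `B y' + Ω y`. -/
def diracExpr (y : ℝ → Vec2) (x : ℝ) : Vec2 :=
  !₂[deriv (fun t => y t 1) x + P.p x * y x 0 + P.q x * y x 1,
    -deriv (fun t => y t 0) x + P.q x * y x 0 - P.p x * y x 1]

/-- `l(y) = ρ⁻¹ (B y' + Ω y)`. -/
def lExpr (y : ℝ → Vec2) (x : ℝ) : Vec2 := ((P.rho x)⁻¹ : ℂ) • P.diracExpr y x

/-- Both components are absolutely continuous on `[0, π]`. -/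
def IsAC (y : ℝ → Vec2) : Prop :=
  ∀ i, AbsolutelyContinuousOnInterval (fun x => y x i) 0 π

/-- `y` is an (absolutely continuous) solution on `[0, π]` of `B y' + Ω y = z ρ y`. -/
def IsSolution (z : ℂ) (y : ℝ → Vec2) : Prop :=
  IsAC y ∧ ∀ᵐ x ∂volume.restrict (Set.Ioo 0 π), P.diracExpr y x = (z * P.rho x) • y x

/-- `z` is an eigenvalue of the boundary value problem: there is a nontrivial solution that
satisfies both boundary conditions. -/
def IsEigenvalue (z : ℂ) : Prop :=
  ∃ y : ℝ → Vec2, P.IsSolution z y ∧ (∃ x ∈ Set.Icc 0 π, y x ≠ 0) ∧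
    y 0 0 = 0 ∧ (z + P.h₁) * y π 0 + P.h₂ * y π 1 = 0

/-- `e` lists all the eigenvalues, each of them once, as real numbers indexed by `ℤ`. -/
def IsEigenvalueEnumeration (e : ℤ → ℝ) : Prop :=
  Function.Injective e ∧ Set.range (fun n => (e n : ℂ)) = {z : ℂ | P.IsEigenvalue z}

/-- `φ(·, z)`: the solution with `φ(0, z) = (0, -1)ᵀ` (unique on `[0, π]`, where alone it is
used). -/
def phi (z : ℂ) : ℝ → Vec2 :=
  Classical.epsilon fun y : ℝ → Vec2 => P.IsSolution z y ∧ y 0 = !₂[0, -1]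

/-- The inner product of `H = L_{2,ρ}(0, π; ℂ²) ⊕ ℂ`. -/
def innerH (Y Z : (ℝ → Vec2) × ℂ) : ℂ :=
  (∫ x, (Y.1 x 0 * conj (Z.1 x 0) + Y.1 x 1 * conj (Z.1 x 1)) ∂P.wMeasure) +
    (1 / P.h₂ : ℂ) * (Y.2 * conj Z.2)

/-- The square of the norm of `H`. -/
def normSqH (Y : (ℝ → Vec2) × ℂ) : ℝ :=
  (∫ x, (‖Y.1 x 0‖ ^ 2 + ‖Y.1 x 1‖ ^ 2) ∂P.wMeasure) + 1 / P.h₂ * ‖Y.2‖ ^ 2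

/-- Membership of (a representative of) an element in `H`. -/
def MemH (Y : (ℝ → Vec2) × ℂ) : Prop := MemLp Y.1 2 P.wMeasure

/-- The domain `D(L)` of the operator
`L (y, y₃) = (l(y), -h₁ y₁(π) - h₂ y₂(π))` in `H`; the function component is given by its
absolutely continuous representative. -/
def InDomain (Y : (ℝ → Vec2) × ℂ) : Prop :=
  P.MemH Y ∧ IsAC Y.1 ∧ Y.2 = Y.1 π 0 ∧ MemLp (P.lExpr Y.1) 2 P.wMeasure ∧ Y.1 0 0 = 0

/-- The eigenvector `(φ(·, z), φ₁(π, z))` of `L`, for an eigenvalue `z`. -/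
def eigenvector (z : ℂ) : (ℝ → Vec2) × ℂ := (P.phi z, P.phi z π 0)

/-- The normalizing number
`∫₀^π (|φ₁(x,z)|² + |φ₂(x,z)|²) ρ(x) dx + |φ₁(π,z)|² / h₂`, for an eigenvalue `z`. -/
def normalizing (z : ℂ) : ℝ := P.normSqH (P.eigenvector z)

/-- The coefficient `⟨Y, φ(·, z)⟩ / α(z)` of `Y ∈ H`, for an eigenvalue `z`. -/
def coeff (Y : (ℝ → Vec2) × ℂ) (z : ℂ) : ℂ :=
  P.innerH Y (P.eigenvector z) / P.normalizing z

end DiracProblem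

end

/-!
The problem is the eigenvalue problem of the operator `L (y, y₁(π)) = (l(y), -h₁ y₁(π) - h₂ y₂(π))`
in `L_{2,ρ} ⊕ ℂ`, and the theorem is the spectral theorem for its compact self-adjoint resolvent.

* Integral form. `l(y) = z y + g` is equivalent to the Volterra equation `y = y(0) + V_z y + ∫ ρ B⁻¹ g`
  in `C[0, π]`, where `V_z` has a coefficient in `L²`. By Cauchy–Schwarz the iterates of `V_z` decay
  like `(Cⁿ / n!)^{1/2}`, so `1 - V_z` is invertible (`isUnit_one_sub_volterraL`). This gives
  existence and uniqueness for the initial value problem; in particular every eigenfunction is a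
  multiple of `φ(·, z)`.
* Symmetry. Lagrange's identity (`integral_lagrange`) makes `L` symmetric, with `h₂ > 0` giving the
  right weight of the scalar component. Hence eigenvalues are real and eigenvectors orthogonal; as the
  space is separable, some real `μ` is not an eigenvalue.
* Resolvent. For such `μ`, adding a multiple of `φ(·, μ)` to a particular solution adjusts the
  boundary condition at `π`. So `(L - μ)⁻¹` exists and is continuous into `C[0, π]` (`resolventL`).
  It is compact since integration from `L²` to `C[0, π]` is, by Arzelà–Ascoli.
* Expansion. The spectral theorem for compact self-adjoint operators shows that the eigenvectors form
  an orthogonal basis (`orthogonal_span_eigvec_eq_bot`), which gives Parseval, convergence in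
  `L_{2,ρ}` and completeness. There are infinitely many eigenvalues because the resolvent is injective
  but not surjective. If `F` is in the domain, then `F = (L - μ)⁻¹ G`, and the
  expansion of `F` is the image of that of `G` under the resolvent; the latter being continuous into
  `C[0, π]`, the series converges uniformly (`IsEigenvalueEnumeration.tendstoUniformlyOn`).
-/

/-! ### Absolutely continuous functions with values in a normed space -/

lemma intervalIntegrable_ofReal_comp {f : ℝ → ℝ} {a b : ℝ}
    (hf : IntervalIntegrable f volume a b) :
    IntervalIntegrable (fun x => (f x : ℂ)) volume a b :=
  ⟨Integrable.ofReal hf.1, Integrable.ofReal hf.2⟩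

namespace AbsolutelyContinuousOnInterval

lemma of_dist_le {X Y : Type*} [PseudoMetricSpace X] [PseudoMetricSpace Y] {f : ℝ → X} {g : ℝ → Y}
    {a b : ℝ} (hg : AbsolutelyContinuousOnInterval g a b)
    (h : ∀ x ∈ Set.uIcc a b, ∀ y ∈ Set.uIcc a b, dist (f x) (f y) ≤ dist (g x) (g y)) :
    AbsolutelyContinuousOnInterval f a b := by
  rw [absolutelyContinuousOnInterval_iff] at hg ⊢
  intro ε hε
  obtain ⟨δ, hδ, H⟩ := hg ε hε
  refine ⟨δ, hδ, fun E hE hd => lt_of_le_of_lt (Finset.sum_le_sum fun i hi => ?_) (H E hE hd)⟩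
  have := hE.1 i hi
  exact h _ this.1 _ this.2

lemma ae_hasDerivAt_complex {f : ℝ → ℂ} {a b : ℝ} (hf : AbsolutelyContinuousOnInterval f a b) :
    ∀ᵐ x : ℝ, x ∈ Set.uIcc a b → HasDerivAt f (deriv f x) x := by
  filter_upwards [hf.boundedVariationOn.ae_differentiableAt_of_mem_uIcc] with x hx h
  exact (hx h).hasDerivAt

lemma deriv_ae_eq_complex {f : ℝ → ℂ} {a b : ℝ} (hf : AbsolutelyContinuousOnInterval f a b) :
    ∀ᵐ x : ℝ, x ∈ Set.uIoc a b → deriv f x = ((deriv (fun t => (f t).re) x : ℝ) : ℂ) +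
      ((deriv (fun t => (f t).im) x : ℝ) : ℂ) * Complex.I := by
  filter_upwards [hf.ae_hasDerivAt_complex] with x hx h
  have h1 := hx (Set.uIoc_subset_uIcc h)
  have hr : HasDerivAt (fun t => (f t).re) (deriv f x).re x :=
    (Complex.reCLM.hasFDerivAt.comp_hasDerivAt x h1)
  have hi : HasDerivAt (fun t => (f t).im) (deriv f x).im x :=
    (Complex.imCLM.hasFDerivAt.comp_hasDerivAt x h1)
  rw [hr.deriv, hi.deriv, Complex.re_add_im]

lemma re {f : ℝ → ℂ} {a b : ℝ} (hf : AbsolutelyContinuousOnInterval f a b) :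
    AbsolutelyContinuousOnInterval (fun t => (f t).re) a b :=
  hf.of_dist_le fun x _ y _ => by
    rw [dist_eq_norm, dist_eq_norm, ← Complex.sub_re]; exact Complex.abs_re_le_norm _

lemma im {f : ℝ → ℂ} {a b : ℝ} (hf : AbsolutelyContinuousOnInterval f a b) :
    AbsolutelyContinuousOnInterval (fun t => (f t).im) a b :=
  hf.of_dist_le fun x _ y _ => by
    rw [dist_eq_norm, dist_eq_norm, ← Complex.sub_im]; exact Complex.abs_im_le_norm _

lemma star_comp {f : ℝ → ℂ} {a b : ℝ} (hf : AbsolutelyContinuousOnInterval f a b) :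
    AbsolutelyContinuousOnInterval (fun t => conj (f t)) a b :=
  hf.of_dist_le fun x _ y _ => by
    rw [dist_eq_norm, dist_eq_norm, ← map_sub, RCLike.norm_conj]

lemma intervalIntegrable_deriv_complex {f : ℝ → ℂ} {a b : ℝ}
    (hf : AbsolutelyContinuousOnInterval f a b) : IntervalIntegrable (deriv f) volume a b := by
  have h : IntervalIntegrable (fun x => ((deriv (fun t => (f t).re) x : ℝ) : ℂ) +
      ((deriv (fun t => (f t).im) x : ℝ) : ℂ) * Complex.I) volume a b :=
    (intervalIntegrable_ofReal_comp hf.re.intervalIntegrable_deriv).add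
      ((intervalIntegrable_ofReal_comp hf.im.intervalIntegrable_deriv).mul_const _)
  refine h.congr_ae ?_
  rw [EventuallyEq, ae_restrict_iff' measurableSet_uIoc]
  filter_upwards [hf.deriv_ae_eq_complex] with x hx h
  exact (hx h).symm

lemma integral_deriv_eq_sub_complex {f : ℝ → ℂ} {a b : ℝ}
    (hf : AbsolutelyContinuousOnInterval f a b) : ∫ x in a..b, deriv f x = f b - f a := by
  rw [intervalIntegral.integral_congr_ae hf.deriv_ae_eq_complex, intervalIntegral.integral_add
    (intervalIntegrable_ofReal_comp hf.re.intervalIntegrable_deriv)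
    ((intervalIntegrable_ofReal_comp hf.im.intervalIntegrable_deriv).mul_const _),
    intervalIntegral.integral_mul_const, intervalIntegral.integral_ofReal,
    intervalIntegral.integral_ofReal, hf.re.integral_deriv_eq_sub, hf.im.integral_deriv_eq_sub]
  apply Complex.ext <;> simp

end AbsolutelyContinuousOnInterval

lemma IntervalIntegrable.absolutelyContinuousOnInterval_integral {E : Type*}
    [NormedAddCommGroup E] [NormedSpace ℝ E] {w : ℝ → E} {a b : ℝ}
    (hw : IntervalIntegrable w volume a b) :
    AbsolutelyContinuousOnInterval (fun x => ∫ t in a..x, w t) a b := by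
  refine (hw.norm.absolutelyContinuousOnInterval_intervalIntegral
    (c := a) Set.left_mem_uIcc).of_dist_le fun x hx y hy => ?_
  have hi : ∀ z ∈ Set.uIcc a b, IntervalIntegrable w volume a z := fun z hz =>
    hw.mono_set (Set.uIcc_subset_uIcc_left hz)
  rw [dist_eq_norm, dist_eq_norm, intervalIntegral.integral_interval_sub_left (hi x hx) (hi y hy),
    intervalIntegral.integral_interval_sub_left (hi x hx).norm (hi y hy).norm]
  exact intervalIntegral.norm_integral_le_abs_integral_norm

/-! ### Primitives of square integrable functions -/

section Primitive

variable {E : Type*} [NormedAddCommGroup E] [NormedSpace ℂ E]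

/-- The Cauchy–Schwarz bound for the integral of a square integrable function over a set. -/
lemma norm_setIntegral_sq_le {α : Type*} [MeasurableSpace α] {μ : Measure α} [IsFiniteMeasure μ]
    {g : α → E} (hg : MemLp g 2 μ) (s : Set α) :
    ‖∫ x in s, g x ∂μ‖ ^ 2 ≤ μ.real s * (eLpNorm g 2 μ).toReal ^ 2 := by
  have h0 : ‖∫ x in s, g x ∂μ‖ₑ ≤ eLpNorm g 2 μ * (μ s) ^ (1 / 2 : ℝ) := by
    calc ‖∫ x in s, g x ∂μ‖ₑ ≤ ∫⁻ x in s, ‖g x‖ₑ ∂μ := enorm_integral_le_lintegral_enorm _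
      _ = eLpNorm g 1 (μ.restrict s) := eLpNorm_one_eq_lintegral_enorm.symm
      _ ≤ eLpNorm g 2 (μ.restrict s) *
          (μ.restrict s) Set.univ ^ (1 / (1 : ℝ≥0∞).toReal - 1 / (2 : ℝ≥0∞).toReal) :=
        eLpNorm_le_eLpNorm_mul_rpow_measure_univ (by norm_num) hg.1.restrict
      _ ≤ eLpNorm g 2 μ * (μ s) ^ (1 / 2 : ℝ) := by
        rw [Measure.restrict_apply_univ]
        rw [show 1 / (1 : ℝ≥0∞).toReal - 1 / (2 : ℝ≥0∞).toReal = (1 / 2 : ℝ) by norm_num]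
        gcongr
        exact Measure.restrict_le_self
  have h1 : ‖∫ x in s, g x ∂μ‖ ≤ (eLpNorm g 2 μ).toReal * (μ.real s) ^ (1 / 2 : ℝ) := by
    have := ENNReal.toReal_mono (ENNReal.mul_ne_top hg.2.ne (by finiteness)) h0
    rwa [toReal_enorm, ENNReal.toReal_mul, ← ENNReal.toReal_rpow] at this
  calc _ ≤ ((eLpNorm g 2 μ).toReal * (μ.real s) ^ (1 / 2 : ℝ)) ^ 2 := by gcongr
    _ = _ := by
      rw [mul_pow, ← Real.rpow_natCast (μ.real s ^ _), ← Real.rpow_mul measureReal_nonneg]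
      norm_num [mul_comm]

end Primitive

/-! ### Integration as a compact operator from `L²` to `C[0, π]` -/

noncomputable section PrimitiveOperator

variable {E : Type*} [NormedAddCommGroup E]

lemma MeasureTheory.MemLp.integrable_two {α : Type*} [MeasurableSpace α] {μ : Measure α}
    [IsFiniteMeasure μ] {g : α → E} (hg : MemLp g 2 μ) : Integrable g μ :=
  hg.integrable (by norm_num)

variable [NormedSpace ℂ E]

/-- Hölder continuity with exponent `1/2` of the primitive of a square integrable function. -/
lemma norm_primitive_sub_sq_le {μ : Measure ℝ} [IsFiniteMeasure μ] {K : ℝ} (hK : 0 ≤ K)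
    (hμ : μ ≤ ENNReal.ofReal K • volume) {g : ℝ → E} (hg : MemLp g 2 μ) {x y : ℝ}
    (hx : 0 ≤ x) (hy : 0 ≤ y) :
    ‖(∫ t in Set.Ioc 0 x, g t ∂μ) - ∫ t in Set.Ioc 0 y, g t ∂μ‖ ^ 2 ≤
      K * |x - y| * (eLpNorm g 2 μ).toReal ^ 2 := by
  wlog hxy : y ≤ x generalizing x y
  · rw [norm_sub_rev, abs_sub_comm]
    exact this hy hx (le_of_not_ge hxy)
  have hu : Set.Ioc 0 x = Set.Ioc 0 y ∪ Set.Ioc y x := (Set.Ioc_union_Ioc_eq_Ioc hy hxy).symm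
  have hd : Disjoint (Set.Ioc 0 y) (Set.Ioc y x) := Set.Ioc_disjoint_Ioc_of_le le_rfl
  rw [hu, setIntegral_union hd measurableSet_Ioc hg.integrable_two.integrableOn
    hg.integrable_two.integrableOn, add_sub_cancel_left]
  refine (norm_setIntegral_sq_le hg _).trans ?_
  gcongr
  have h1 := hμ (Set.Ioc y x)
  rw [Measure.smul_apply, Real.volume_Ioc, smul_eq_mul, ← ENNReal.ofReal_mul hK] at h1
  rw [abs_of_nonneg (sub_nonneg.2 hxy)]
  exact ENNReal.toReal_le_of_le_ofReal (by have := sub_nonneg.2 hxy; positivity) h1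

lemma continuous_primitive_of_memLp {μ : Measure ℝ} [IsFiniteMeasure μ] {K : ℝ} (hK : 0 ≤ K)
    (hμ : μ ≤ ENNReal.ofReal K • volume) {g : ℝ → E} (hg : MemLp g 2 μ) :
    Continuous fun x : Set.Icc (0 : ℝ) π => ∫ t in Set.Ioc 0 (x : ℝ), g t ∂μ := by
  rw [continuous_iff_continuousAt]
  intro y
  rw [ContinuousAt, tendsto_iff_norm_sub_tendsto_zero]
  have h : Tendsto (fun x : Set.Icc (0 : ℝ) π =>
      √(K * |(x : ℝ) - y| * (eLpNorm g 2 μ).toReal ^ 2)) (𝓝 y) (𝓝 0) := by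
    have : Continuous fun x : Set.Icc (0 : ℝ) π =>
      √(K * |(x : ℝ) - y| * (eLpNorm g 2 μ).toReal ^ 2) := by fun_prop
    simpa using this.tendsto y
  refine squeeze_zero (fun _ => norm_nonneg _) (fun x => ?_) h
  exact Real.le_sqrt_of_sq_le (norm_primitive_sub_sq_le hK hμ hg x.2.1 y.2.1)

/-- The operator `g ↦ (x ↦ ∫_(0,x] g dμ)` from `L²(μ)` to `C[0, π]`, for a measure `μ ≤ K dx`. -/
def primitiveL (E : Type*) [NormedAddCommGroup E] [NormedSpace ℂ E]
    (μ : Measure ℝ) [IsFiniteMeasure μ] {K : ℝ} (hK : 0 ≤ K)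
    (hμ : μ ≤ ENNReal.ofReal K • volume) : Lp E 2 μ →L[ℂ] C(Set.Icc (0 : ℝ) π, E) :=
  LinearMap.mkContinuous
    { toFun := fun g => ⟨fun x => ∫ t in Set.Ioc 0 (x : ℝ), g t ∂μ,
        continuous_primitive_of_memLp hK hμ (Lp.memLp g)⟩
      map_add' := fun f g => by
        ext x
        simp only [ContinuousMap.coe_mk, ContinuousMap.add_apply]
        rw [← integral_add (Lp.memLp f).integrable_two.integrableOn
          (Lp.memLp g).integrable_two.integrableOn]
        exact integral_congr_ae (ae_restrict_of_ae (Lp.coeFn_add f g))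
      map_smul' := fun c g => by
        ext x
        simp only [ContinuousMap.coe_mk, ContinuousMap.smul_apply, RingHom.id_apply]
        rw [← integral_smul]
        exact integral_congr_ae (ae_restrict_of_ae (Lp.coeFn_smul c g)) }
    (√(K * π)) (fun g => by
      rw [ContinuousMap.norm_le _ (by positivity)]
      intro x
      refine abs_le_of_sq_le_sq' ?_ (by positivity) |>.2
      have h := norm_primitive_sub_sq_le hK hμ (Lp.memLp g) x.2.1 le_rfl
      simp only [Set.Ioc_self, Measure.restrict_empty, integral_zero_measure, sub_zero] at h
      rw [mul_pow, Real.sq_sqrt (by positivity), Lp.norm_def]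
      refine h.trans ?_
      gcongr
      rw [abs_of_nonneg x.2.1]
      exact x.2.2)

lemma primitiveL_apply {μ : Measure ℝ} [IsFiniteMeasure μ] {K : ℝ} (hK : 0 ≤ K)
    (hμ : μ ≤ ENNReal.ofReal K • volume) (g : Lp E 2 μ) (x : Set.Icc (0 : ℝ) π) :
    primitiveL E μ hK hμ g x = ∫ t in Set.Ioc 0 (x : ℝ), g t ∂μ := rfl

/-- By the Arzelà–Ascoli theorem, integration is a compact operator from `L²` to `C[0, π]`. -/
lemma isCompactOperator_primitiveL [ProperSpace E] {μ : Measure ℝ} [IsFiniteMeasure μ] {K : ℝ}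
    (hK : 0 ≤ K) (hμ : μ ≤ ENNReal.ofReal K • volume) :
    IsCompactOperator (primitiveL E μ hK hμ) := by
  set W := primitiveL E μ hK hμ
  let e := ContinuousMap.isometryEquivBoundedOfCompact (Set.Icc (0 : ℝ) π) E
  set A : Set (BoundedContinuousFunction (Set.Icc (0 : ℝ) π) E) :=
    (fun g => e (W g)) '' Metric.closedBall 0 1 with hA
  have hcomp : IsCompact (closure A) := by
    refine BoundedContinuousFunction.arzela_ascoli (Metric.closedBall 0 ‖W‖)
      (isCompact_closedBall _ _) A ?_ ?_
    · rintro _ x ⟨g, hg, rfl⟩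
      rw [mem_closedBall_zero_iff] at hg ⊢
      calc ‖W g x‖ ≤ ‖W g‖ := ContinuousMap.norm_coe_le_norm _ _
        _ ≤ ‖W‖ * ‖g‖ := W.le_opNorm g
        _ ≤ ‖W‖ := mul_le_of_le_one_right W.opNorm_nonneg hg
    · refine Metric.equicontinuous_of_continuity_modulus (fun d => √(K * d)) ?_ _ ?_
      · have : Continuous fun d : ℝ => √(K * d) := by fun_prop
        simpa using this.tendsto 0
      · rintro x y ⟨_, g, hg, rfl⟩
        rw [mem_closedBall_zero_iff] at hg
        rw [dist_eq_norm]
        refine Real.le_sqrt_of_sq_le ?_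
        refine (norm_primitive_sub_sq_le hK hμ (Lp.memLp g) x.2.1 y.2.1).trans ?_
        rw [Subtype.dist_eq, Real.dist_eq, ← Lp.norm_def]
        refine mul_le_of_le_one_right (by positivity) ?_
        exact pow_le_one₀ (norm_nonneg _) hg
  rw [isCompactOperator_iff_exists_mem_nhds_image_subset_compact]
  refine ⟨Metric.closedBall 0 1, Metric.closedBall_mem_nhds _ one_pos, e.symm '' closure A,
    hcomp.image e.symm.continuous, ?_⟩
  rintro _ ⟨g, hg, rfl⟩
  exact ⟨e (W g), subset_closure ⟨g, hg, rfl⟩, e.symm_apply_apply _⟩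

end PrimitiveOperator

/-! ### Volterra equations with square integrable coefficients -/

noncomputable section Volterra

variable {E : Type*} [NormedAddCommGroup E]

/-- The continuous extension of `u ∈ C[0, π]` to the line that is constant outside `[0, π]`. -/
def extendIcc (u : C(Set.Icc (0 : ℝ) π, E)) (t : ℝ) : E := u (Set.projIcc 0 π Real.pi_pos.le t)

lemma continuous_extendIcc (u : C(Set.Icc (0 : ℝ) π, E)) : Continuous (extendIcc u) :=
  u.continuous.comp continuous_projIcc

lemma extendIcc_of_mem (u : C(Set.Icc (0 : ℝ) π, E)) {t : ℝ} (ht : t ∈ Set.Icc 0 π) :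
    extendIcc u t = u ⟨t, ht⟩ := by
  rw [extendIcc, Set.projIcc_of_mem _ ht]

lemma norm_extendIcc_le (u : C(Set.Icc (0 : ℝ) π, E)) (t : ℝ) : ‖extendIcc u t‖ ≤ ‖u‖ :=
  u.norm_coe_le_norm _

variable [NormedSpace ℂ E] {A : ℝ → E →L[ℂ] E}

lemma memLp_apply_extendIcc {ν : Measure ℝ} (hA : MemLp A 2 ν) (u : C(Set.Icc (0 : ℝ) π, E)) :
    MemLp (fun t => A t (extendIcc u t)) 2 ν := by
  refine hA.of_le_mul (c := ‖u‖) ?_ (Eventually.of_forall fun t => ?_)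
  · exact (ContinuousLinearMap.id ℂ (E →L[ℂ] E)).aestronglyMeasurable_comp₂ hA.1
      (continuous_extendIcc u).aestronglyMeasurable
  · calc _ ≤ ‖A t‖ * ‖extendIcc u t‖ := (A t).le_opNorm _
      _ ≤ ‖u‖ * ‖A t‖ := by rw [mul_comm]; gcongr; exact norm_extendIcc_le u t

/-- Multiplication by a square integrable operator function, from `C[0, π]` to `L²`. -/
def mulL {ν : Measure ℝ} (hA : MemLp A 2 ν) : C(Set.Icc (0 : ℝ) π, E) →L[ℂ] Lp E 2 ν :=
  LinearMap.mkContinuous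
    { toFun := fun u => (memLp_apply_extendIcc hA u).toLp
      map_add' := fun u v => by
        rw [← MemLp.toLp_add]
        exact MemLp.toLp_congr _ _ (Eventually.of_forall fun t => map_add (A t) _ _)
      map_smul' := fun c u => by
        rw [RingHom.id_apply, ← MemLp.toLp_const_smul]
        exact MemLp.toLp_congr _ _ (Eventually.of_forall fun t => map_smul (A t) _ _) }
    ‖hA.toLp‖ (fun u => by
      rw [mul_comm]
      refine Lp.norm_le_mul_norm_of_ae_le_mul ?_
      filter_upwards [hA.coeFn_toLp, (memLp_apply_extendIcc hA u).coeFn_toLp] with t h1 h2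
      simp only [LinearMap.coe_mk, AddHom.coe_mk]
      rw [h1, h2, mul_comm]
      exact ((A t).le_opNorm _).trans (by gcongr; exact norm_extendIcc_le u t))

lemma coeFn_mulL {ν : Measure ℝ} (hA : MemLp A 2 ν) (u : C(Set.Icc (0 : ℝ) π, E)) :
    mulL hA u =ᵐ[ν] fun t => A t (extendIcc u t) :=
  (memLp_apply_extendIcc hA u).coeFn_toLp

lemma restrict_le_ofReal_one_smul :
    (volume.restrict (Set.Ioo 0 π) : Measure ℝ) ≤ ENNReal.ofReal 1 • volume := by
  rw [ENNReal.ofReal_one, one_smul]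
  exact Measure.restrict_le_self

/-- The Volterra operator `(V u)(x) = ∫₀ˣ A(t) u(t) dt` on `C[0, π]`. -/
def volterraL (hA : MemLp A 2 (volume.restrict (Set.Ioo 0 π))) :
    C(Set.Icc (0 : ℝ) π, E) →L[ℂ] C(Set.Icc (0 : ℝ) π, E) :=
  (primitiveL E _ zero_le_one restrict_le_ofReal_one_smul).comp (mulL hA)

lemma volterraL_apply (hA : MemLp A 2 (volume.restrict (Set.Ioo 0 π)))
    (u : C(Set.Icc (0 : ℝ) π, E)) (x : Set.Icc (0 : ℝ) π) :
    volterraL hA u x = ∫ t in (0 : ℝ)..x, A t (extendIcc u t) := by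
  rw [volterraL, ContinuousLinearMap.comp_apply, primitiveL_apply,
    integral_congr_ae (ae_restrict_of_ae (coeFn_mulL hA u)),
    intervalIntegral.integral_of_le x.2.1, restrict_Ioo_eq_restrict_Ioc,
    Measure.restrict_restrict measurableSet_Ioc,
    Set.inter_eq_left.2 (Set.Ioc_subset_Ioc_right x.2.2)]

/-- The squared norm of the `n`-th iterate of the Volterra operator is at most `(c π)ⁿ / n!` with
`c = ∫ ‖A‖²`; the induction step is Cauchy–Schwarz. -/
lemma norm_volterraL_pow_apply_sq_le (hA : MemLp A 2 (volume.restrict (Set.Ioo 0 π)))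
    (n : ℕ) (u : C(Set.Icc (0 : ℝ) π, E)) (x : Set.Icc (0 : ℝ) π) :
    ‖((volterraL hA) ^ n) u x‖ ^ 2 ≤
      ((∫ t in Set.Ioo 0 π, ‖A t‖ ^ 2) * x) ^ n / n.factorial * ‖u‖ ^ 2 := by
  set c := ∫ t in Set.Ioo 0 π, ‖A t‖ ^ 2 with hc
  have hc0 : 0 ≤ c := integral_nonneg fun t => by positivity
  induction n generalizing x with
  | zero =>
    simp only [pow_zero, Nat.factorial_zero, Nat.cast_one, div_one, one_mul]
    gcongr
    exact u.norm_coe_le_norm x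
  | succ n ih =>
    set v := ((volterraL hA) ^ n) u with hv
    have hpow : ((volterraL hA) ^ (n + 1)) u = volterraL hA v := by
      rw [pow_succ' (volterraL hA)]; rfl
    rw [hpow, volterraL_apply, intervalIntegral.integral_of_le x.2.1]
    set b : ℝ → ℝ := fun t => √((c * t) ^ n / n.factorial * ‖u‖ ^ 2) with hb
    have hx : (Set.Ioc 0 (x : ℝ)) ⊆ Set.Ioc 0 π := Set.Ioc_subset_Ioc_right x.2.2
    have hA' : MemLp A 2 (volume.restrict (Set.Ioc 0 (x : ℝ))) := by
      rw [restrict_Ioo_eq_restrict_Ioc] at hA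
      exact hA.mono_measure (Measure.restrict_mono hx le_rfl)
    have hbc : Continuous b := by fun_prop
    have hb2 : MemLp b 2 (volume.restrict (Set.Ioc 0 (x : ℝ))) :=
      (memLp_two_iff_integrable_sq hbc.aestronglyMeasurable).2 (hbc.pow 2).integrableOn_Ioc
    have h1 : ‖∫ t in Set.Ioc 0 (x : ℝ), A t (extendIcc v t)‖ ≤
        ∫ t in Set.Ioc 0 (x : ℝ), ‖A t‖ * b t := by
      refine norm_integral_le_of_norm_le (hA'.norm.integrable_mul hb2) ?_
      rw [ae_restrict_iff' measurableSet_Ioc]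
      refine Eventually.of_forall fun t ht => ((A t).le_opNorm _).trans ?_
      gcongr
      refine Real.le_sqrt_of_sq_le ?_
      rw [extendIcc_of_mem v ⟨ht.1.le, ht.2.trans x.2.2⟩]
      exact ih ⟨t, ht.1.le, ht.2.trans x.2.2⟩
    have h2 := integral_mul_le_Lp_mul_Lq_of_nonneg (μ := volume.restrict (Set.Ioc 0 (x : ℝ)))
      (p := 2) (q := 2) ⟨by norm_num, by norm_num, by norm_num⟩ (f := fun t => ‖A t‖) (g := b)
      (Eventually.of_forall fun _ => norm_nonneg _) (Eventually.of_forall fun _ => Real.sqrt_nonneg _)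
      (by simpa using hA'.norm) (by simpa using hb2)
    simp only [Real.rpow_two] at h2
    have h3 : ∫ t in Set.Ioc 0 (x : ℝ), ‖A t‖ ^ 2 ≤ c := by
      rw [hc, restrict_Ioo_eq_restrict_Ioc]
      rw [restrict_Ioo_eq_restrict_Ioc] at hA
      refine setIntegral_mono_set (hA.norm.integrable_sq)
        (Eventually.of_forall fun t => by positivity) (LE.le.eventuallyLE hx)
    have h4 : ∫ t in Set.Ioc 0 (x : ℝ), b t ^ 2 =
        c ^ n / n.factorial * ‖u‖ ^ 2 * ((x : ℝ) ^ (n + 1) / (n + 1)) := by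
      have : ∫ t in Set.Ioc 0 (x : ℝ), b t ^ 2 =
          ∫ t in Set.Ioc 0 (x : ℝ), c ^ n / n.factorial * ‖u‖ ^ 2 * t ^ n := by
        refine setIntegral_congr_fun measurableSet_Ioc fun t ht => ?_
        have : 0 ≤ t := ht.1.le
        simp only [hb]
        rw [Real.sq_sqrt (by positivity)]
        ring
      rw [this, ← intervalIntegral.integral_of_le x.2.1, intervalIntegral.integral_const_mul,
        integral_pow]
      simp
    have hx0 : (0 : ℝ) ≤ x := x.2.1
    have hI : 0 ≤ ∫ t in Set.Ioc 0 (x : ℝ), ‖A t‖ ^ 2 := integral_nonneg fun t => by positivity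
    have h5 : ‖∫ t in Set.Ioc 0 (x : ℝ), A t (extendIcc v t)‖ ≤
        √c * √(c ^ n / n.factorial * ‖u‖ ^ 2 * ((x : ℝ) ^ (n + 1) / (n + 1))) := by
      refine h1.trans (h2.trans ?_)
      rw [h4, ← Real.sqrt_eq_rpow, ← Real.sqrt_eq_rpow]
      gcongr
    calc _ ≤ (√c * √(c ^ n / n.factorial * ‖u‖ ^ 2 * ((x : ℝ) ^ (n + 1) / (n + 1)))) ^ 2 := by
          gcongr
      _ = _ := by
        rw [mul_pow, Real.sq_sqrt hc0, Real.sq_sqrt (by positivity), Nat.factorial_succ]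
        push_cast
        field_simp
        ring

/-- Unique solvability of `u - V u = f`: some power of `V` has norm less than one. -/
lemma isUnit_one_sub_volterraL [CompleteSpace E]
    (hA : MemLp A 2 (volume.restrict (Set.Ioo 0 π))) :
    IsUnit (1 - volterraL hA) := by
  set c := ∫ t in Set.Ioo 0 π, ‖A t‖ ^ 2 with hc
  have hc0 : 0 ≤ c := integral_nonneg fun t => by positivity
  obtain ⟨n, hn⟩ : ∃ n : ℕ, (c * π) ^ n / n.factorial < 1 / 4 :=
    ((FloorSemiring.tendsto_pow_div_factorial_atTop (c * π)).eventually
      (gt_mem_nhds (by norm_num))).exists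
  have hV : ‖(volterraL hA) ^ n‖ ≤ 1 / 2 := by
    refine ContinuousLinearMap.opNorm_le_bound _ (by norm_num) fun u => ?_
    rw [ContinuousMap.norm_le _ (by positivity)]
    intro x
    refine (abs_le_of_sq_le_sq' ?_ (by positivity)).2
    refine (norm_volterraL_pow_apply_sq_le hA n u x).trans ?_
    rw [mul_pow (1 / 2 : ℝ), ← hc]
    gcongr
    have hx0 : (0 : ℝ) ≤ x := x.2.1
    have : (c * x) ^ n / n.factorial ≤ (c * π) ^ n / n.factorial := by
      gcongr
      exact x.2.2
    linarith
  have h1 : IsUnit (1 - (volterraL hA) ^ n) := (Units.oneSub ((volterraL hA) ^ n) (by linarith)).isUnit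
  rw [← mul_neg_geom_sum] at h1
  have hcm : Commute (1 - volterraL hA) (∑ i ∈ Finset.range n, (volterraL hA) ^ i) := by
    rw [Commute, SemiconjBy, mul_neg_geom_sum, geom_sum_mul_neg]
  exact (hcm.isUnit_mul_iff.1 h1).1

end Volterra

/-! ### The weighted measure -/

noncomputable section Weight

namespace DiracProblem

variable (P : DiracProblem)

lemma rho_pos (x : ℝ) : 0 < P.rho x := by
  rw [rho]; split_ifs
  exacts [one_pos, P.α_pos]

lemma rho_le (x : ℝ) : P.rho x ≤ max 1 P.α := by
  rw [rho]; split_ifs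
  exacts [le_max_left _ _, le_max_right _ _]

lemma measurable_rho : Measurable P.rho :=
  Measurable.ite measurableSet_Iic measurable_const measurable_const

lemma rho_ofReal_ne_zero (x : ℝ) : (P.rho x : ℂ) ≠ 0 :=
  Complex.ofReal_ne_zero.2 (P.rho_pos x).ne'

lemma max_one_α_nonneg : 0 ≤ max 1 P.α := zero_le_one.trans (le_max_left _ _)

lemma wMeasure_le : P.wMeasure ≤ ENNReal.ofReal (max 1 P.α) • volume := by
  calc P.wMeasure ≤ (volume.restrict (Set.Ioo 0 π)).withDensity
        (fun _ => ENNReal.ofReal (max 1 P.α)) :=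
        withDensity_mono (Eventually.of_forall fun x => ENNReal.ofReal_le_ofReal (P.rho_le x))
    _ = ENNReal.ofReal (max 1 P.α) • volume.restrict (Set.Ioo 0 π) := withDensity_const _
    _ ≤ _ := by gcongr; exact Measure.restrict_le_self

instance : IsFiniteMeasure P.wMeasure := by
  refine isFiniteMeasure_withDensity_ofReal ?_
  refine (HasFiniteIntegral.of_bounded (C := max 1 P.α) (Eventually.of_forall fun x => ?_))
  rw [Real.norm_of_nonneg (P.rho_pos x).le]
  exact P.rho_le x

lemma ae_wMeasure_iff {p : ℝ → Prop} :
    (∀ᵐ x ∂P.wMeasure, p x) ↔ ∀ᵐ x ∂volume.restrict (Set.Ioo 0 π), p x := by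
  have h1 : P.wMeasure ≪ volume.restrict (Set.Ioo 0 π) := withDensity_absolutelyContinuous _ _
  have h2 : volume.restrict (Set.Ioo 0 π) ≪ P.wMeasure := by
    refine withDensity_absolutelyContinuous' (P.measurable_rho.ennreal_ofReal.aemeasurable) ?_
    exact Eventually.of_forall fun x => (ENNReal.ofReal_pos.2 (P.rho_pos x)).ne'
  exact ⟨fun h => h2.ae_le h, fun h => h1.ae_le h⟩

lemma ae_wMeasure_mem : ∀ᵐ x ∂P.wMeasure, x ∈ Set.Ioo 0 π :=
  P.ae_wMeasure_iff.2 (ae_restrict_mem measurableSet_Ioo)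

variable {E : Type*} [NormedAddCommGroup E] [NormedSpace ℂ E]

lemma setIntegral_wMeasure (g : ℝ → E) {x : ℝ} (hx : x ∈ Set.Icc 0 π) :
    ∫ t in Set.Ioc 0 x, g t ∂P.wMeasure = ∫ t in (0 : ℝ)..x, (P.rho t : ℂ) • g t := by
  rw [wMeasure, setIntegral_withDensity_eq_setIntegral_toReal_smul
    P.measurable_rho.ennreal_ofReal (Eventually.of_forall fun _ => ENNReal.ofReal_lt_top) _
    measurableSet_Ioc, intervalIntegral.integral_of_le hx.1, restrict_Ioo_eq_restrict_Ioc,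
    Measure.restrict_restrict measurableSet_Ioc,
    Set.inter_eq_left.2 (Set.Ioc_subset_Ioc_right hx.2)]
  refine integral_congr_ae (Eventually.of_forall fun t => ?_)
  simp only [ENNReal.toReal_ofReal (P.rho_pos t).le]
  exact (Complex.coe_smul _ _).symm

lemma integral_wMeasure (g : ℝ → E) :
    ∫ t, g t ∂P.wMeasure = ∫ t in (0 : ℝ)..π, (P.rho t : ℂ) • g t := by
  rw [← P.setIntegral_wMeasure g (Set.right_mem_Icc.2 Real.pi_pos.le),
    Measure.restrict_eq_self_of_ae_mem]
  filter_upwards [P.ae_wMeasure_mem] with x hx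
  exact Set.Ioo_subset_Ioc_self hx

lemma intervalIntegrable_rho_smul {g : ℝ → E} (hg : Integrable g P.wMeasure) :
    IntervalIntegrable (fun t => (P.rho t : ℂ) • g t) volume 0 π := by
  rw [wMeasure, integrable_withDensity_iff_integrable_smul' P.measurable_rho.ennreal_ofReal
    (Eventually.of_forall fun _ => ENNReal.ofReal_lt_top), restrict_Ioo_eq_restrict_Ioc] at hg
  rw [intervalIntegrable_iff_integrableOn_Ioc_of_le Real.pi_pos.le]
  refine hg.congr (Eventually.of_forall fun t => ?_)
  simp only [ENNReal.toReal_ofReal (P.rho_pos t).le]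
  exact (Complex.coe_smul _ _).symm

end DiracProblem

end Weight

/-! ### Absolutely continuous two-component functions -/

noncomputable section Components

namespace DiracProblem

/-- The vector of the derivatives of the two components. -/
def derivVec (y : ℝ → Vec2) (x : ℝ) : Vec2 :=
  !₂[deriv (fun t => y t 0) x, deriv (fun t => y t 1) x]

lemma intervalIntegral_apply {w : ℝ → Vec2} {a b : ℝ} (hw : IntervalIntegrable w volume a b)
    (i : Fin 2) : (∫ t in a..b, w t) i = ∫ t in a..b, w t i :=
  ((EuclideanSpace.proj (𝕜 := ℂ) i : Vec2 →L[ℂ] ℂ).intervalIntegral_comp_comm hw).symm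

lemma IsAC.intervalIntegrable_derivVec {y : ℝ → Vec2} (hy : IsAC y) :
    IntervalIntegrable (derivVec y) volume 0 π := by
  have key : ∀ i : Fin 2, IntervalIntegrable
      (fun x => deriv (fun t => y t i) x • EuclideanSpace.single i (1 : ℂ)) volume 0 π := fun i =>
    have h := (hy i).intervalIntegrable_deriv_complex
    ⟨Integrable.smul_const h.1 _, Integrable.smul_const h.2 _⟩
  convert (key 0).add (key 1) using 1
  ext x i
  fin_cases i <;> simp [derivVec]

lemma IsAC.eq_add_integral_derivVec {y : ℝ → Vec2} (hy : IsAC y) {x : ℝ}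
    (hx : x ∈ Set.Icc 0 π) : y x = y 0 + ∫ t in (0 : ℝ)..x, derivVec y t := by
  have hsub : Set.uIcc 0 x ⊆ Set.uIcc 0 π := Set.uIcc_subset_uIcc_left (by
    rwa [Set.uIcc_of_le Real.pi_pos.le])
  have hw := hy.intervalIntegrable_derivVec.mono_set hsub
  ext i
  rw [PiLp.add_apply, intervalIntegral_apply hw]
  fin_cases i
  · have := ((hy 0).mono hsub).integral_deriv_eq_sub_complex
    simp only [derivVec] at this ⊢
    simp [this]
  · have := ((hy 1).mono hsub).integral_deriv_eq_sub_complex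
    simp only [derivVec] at this ⊢
    simp [this]

lemma isAC_of_eq_integral {y w : ℝ → Vec2} (hw : IntervalIntegrable w volume 0 π)
    (h : ∀ x ∈ Set.Icc 0 π, y x = y 0 + ∫ t in (0 : ℝ)..x, w t) : IsAC y := by
  intro i
  refine hw.absolutelyContinuousOnInterval_integral.of_dist_le fun s hs t ht => ?_
  rw [Set.uIcc_of_le Real.pi_pos.le] at hs ht
  rw [h s hs, h t ht, dist_eq_norm, dist_eq_norm, ← PiLp.sub_apply, add_sub_add_left_eq_sub]
  exact PiLp.norm_apply_le _ i

lemma ae_derivVec_eq_of_eq_integral {y w : ℝ → Vec2} (hw : IntervalIntegrable w volume 0 π)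
    (h : ∀ x ∈ Set.Icc 0 π, y x = y 0 + ∫ t in (0 : ℝ)..x, w t) :
    ∀ᵐ x ∂volume.restrict (Set.Ioo 0 π), derivVec y x = w x := by
  rw [ae_restrict_iff' measurableSet_Ioo]
  filter_upwards [hw.ae_hasDerivAt_integral] with x hx hx'
  have hd := hx (by rw [Set.uIcc_of_le Real.pi_pos.le]; exact Set.Ioo_subset_Icc_self hx') 0
    Set.left_mem_uIcc
  have hy : HasDerivAt y (w x) x := by
    refine (hd.const_add (y 0)).congr_of_eventuallyEq ?_
    filter_upwards [Ioo_mem_nhds hx'.1 hx'.2] with s hs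
    exact h s (Set.Ioo_subset_Icc_self hs)
  have hi : ∀ i, deriv (fun t => y t i) x = w x i := fun i =>
    (((EuclideanSpace.proj (𝕜 := ℂ) i : Vec2 →L[ℂ] ℂ).restrictScalars
      ℝ).hasFDerivAt.comp_hasDerivAt x hy).deriv
  ext i
  fin_cases i <;> simp [derivVec, hi]

end DiracProblem

end Components

/-! ### The Dirac system as a Volterra equation -/

noncomputable section System

namespace DiracProblem

/-- The matrix `(1 0; 0 -1)`. -/
def matQ : Vec2 →L[ℂ] Vec2 := Matrix.toEuclideanCLM (n := Fin 2) (𝕜 := ℂ) !![1, 0; 0, -1]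

/-- The matrix `(0 -1; -1 0)`. -/
def matP : Vec2 →L[ℂ] Vec2 := Matrix.toEuclideanCLM (n := Fin 2) (𝕜 := ℂ) !![0, -1; -1, 0]

/-- The matrix `B⁻¹ = (0 -1; 1 0)`. -/
def matJ : Vec2 →L[ℂ] Vec2 := Matrix.toEuclideanCLM (n := Fin 2) (𝕜 := ℂ) !![0, -1; 1, 0]

@[simp] lemma matQ_apply (v : Vec2) : matQ v = !₂[v 0, -v 1] := by
  ext i; fin_cases i <;> simp [matQ, Matrix.vecHead, Matrix.vecTail]

@[simp] lemma matP_apply (v : Vec2) : matP v = !₂[-v 1, -v 0] := by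
  ext i; fin_cases i <;> simp [matP, Matrix.vecHead, Matrix.vecTail]

@[simp] lemma matJ_apply (v : Vec2) : matJ v = !₂[-v 1, v 0] := by
  ext i; fin_cases i <;> simp [matJ, Matrix.vecHead, Matrix.vecTail]

variable (P : DiracProblem)

/-- The coefficient of the system `y' = A_z y + ρ B⁻¹ g` that is equivalent to `l(y) = z y + g`. -/
def coefMat (z : ℂ) (t : ℝ) : Vec2 →L[ℂ] Vec2 :=
  (P.q t : ℂ) • matQ + (P.p t : ℂ) • matP + (z * P.rho t) • matJ

lemma memLp_coefMat (z : ℂ) : MemLp (P.coefMat z) 2 (volume.restrict (Set.Ioo 0 π)) := by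
  have key : ∀ {f : ℝ → ℂ} (c : Vec2 →L[ℂ] Vec2), MemLp f 2 (volume.restrict (Set.Ioo 0 π)) →
      MemLp (fun t => f t • c) 2 (volume.restrict (Set.Ioo 0 π)) := fun c hf =>
    (ContinuousLinearMap.toSpanSingleton ℂ c).comp_memLp' hf
  have hrho : MemLp (fun t => z * (P.rho t : ℂ)) 2 (volume.restrict (Set.Ioo 0 π)) := by
    refine MemLp.const_mul ?_ z
    refine MemLp.of_bound (by have := P.measurable_rho; fun_prop) (max 1 P.α)
      (Eventually.of_forall fun t => ?_)
    rw [Complex.norm_real, Real.norm_of_nonneg (P.rho_pos t).le]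
    exact P.rho_le t
  have hq : MemLp (fun t => (P.q t : ℂ)) 2 (volume.restrict (Set.Ioo 0 π)) := P.q_mem.ofReal
  have hp : MemLp (fun t => (P.p t : ℂ)) 2 (volume.restrict (Set.Ioo 0 π)) := P.p_mem.ofReal
  exact MemLp.add (f := fun t => (P.q t : ℂ) • matQ + (P.p t : ℂ) • matP)
    (g := fun t => (z * P.rho t) • matJ)
    (MemLp.add (f := fun t => (P.q t : ℂ) • matQ) (g := fun t => (P.p t : ℂ) • matP)
      (key matQ hq) (key matP hp)) (key matJ hrho)

lemma lExpr_eq_iff (y : ℝ → Vec2) (z : ℂ) (x : ℝ) (v : Vec2) :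
    P.lExpr y x = z • y x + v ↔
      derivVec y x = P.coefMat z x (y x) + (P.rho x : ℂ) • matJ v := by
  have h : P.lExpr y x = z • y x + v ↔ P.diracExpr y x = (P.rho x : ℂ) • (z • y x + v) := by
    rw [lExpr, inv_smul_eq_iff₀ (P.rho_ofReal_ne_zero x)]
  rw [h, ← WithLp.ofLp_injective 2 |>.eq_iff, ← WithLp.ofLp_injective 2 |>.eq_iff, funext_iff,
    funext_iff, Fin.forall_fin_two, Fin.forall_fin_two]
  simp only [diracExpr, derivVec, coefMat, matQ_apply, matP_apply, matJ_apply, add_apply,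
    smul_apply, PiLp.add_apply, PiLp.smul_apply, smul_eq_mul,
    Matrix.cons_val_zero, Matrix.cons_val_one]
  constructor
  · rintro ⟨h0, h1⟩
    exact ⟨by linear_combination -h1, by linear_combination h0⟩
  · rintro ⟨h0, h1⟩
    exact ⟨by linear_combination h1, by linear_combination -h0⟩

/-- The restriction of an absolutely continuous function to `[0, π]`. -/
def IsAC.toC {y : ℝ → Vec2} (hy : IsAC y) : C(Set.Icc (0 : ℝ) π, Vec2) :=
  ⟨fun x => y x, by
    have h : ∀ i, Continuous fun x : Set.Icc (0 : ℝ) π => y x i := fun i => by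
      have := (hy i).continuousOn
      rw [Set.uIcc_of_le Real.pi_pos.le] at this
      exact this.domRestrict
    exact (PiLp.continuous_toLp 2 _).comp (continuous_pi h)⟩

lemma IsAC.toC_apply {y : ℝ → Vec2} (hy : IsAC y) (x : Set.Icc (0 : ℝ) π) : hy.toC x = y x := rfl

lemma IsAC.extendIcc_toC {y : ℝ → Vec2} (hy : IsAC y) {x : ℝ} (hx : x ∈ Set.Icc 0 π) :
    extendIcc hy.toC x = y x := by
  rw [extendIcc_of_mem _ hx]; rfl

/-- The operator `g ↦ ∫₀ˣ ρ B⁻¹ g dt`. -/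
def forcingL : Lp Vec2 2 P.wMeasure →L[ℂ] C(Set.Icc (0 : ℝ) π, Vec2) :=
  (primitiveL Vec2 P.wMeasure P.max_one_α_nonneg P.wMeasure_le).comp (matJ.compLpL 2 P.wMeasure)

lemma isCompactOperator_forcingL : IsCompactOperator P.forcingL :=
  (isCompactOperator_primitiveL P.max_one_α_nonneg P.wMeasure_le).comp_clm _

lemma forcingL_apply (g : Lp Vec2 2 P.wMeasure) (x : Set.Icc (0 : ℝ) π) :
    P.forcingL g x = ∫ t in (0 : ℝ)..x, (P.rho t : ℂ) • matJ (g t) := by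
  rw [← P.setIntegral_wMeasure _ x.2, forcingL, ContinuousLinearMap.comp_apply, primitiveL_apply]
  exact integral_congr_ae (ae_restrict_of_ae (matJ.coeFn_compLpL g))

/-- The Volterra operator of the system `y' = A_z y`. -/
def sysV (z : ℂ) : C(Set.Icc (0 : ℝ) π, Vec2) →L[ℂ] C(Set.Icc (0 : ℝ) π, Vec2) :=
  volterraL (P.memLp_coefMat z)

/-- The inverse of `1 - V_z`. -/
def solveL (z : ℂ) : C(Set.Icc (0 : ℝ) π, Vec2) →L[ℂ] C(Set.Icc (0 : ℝ) π, Vec2) :=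
  ↑(isUnit_one_sub_volterraL (P.memLp_coefMat z)).unit⁻¹

lemma eq_solveL_iff (z : ℂ) (u f : C(Set.Icc (0 : ℝ) π, Vec2)) :
    u = P.solveL z f ↔ u = f + P.sysV z u := by
  have hU := isUnit_one_sub_volterraL (P.memLp_coefMat z)
  have h1 : ∀ w, P.solveL z ((1 - P.sysV z) w) = w := fun w =>
    congrArg (fun T : C(Set.Icc (0 : ℝ) π, Vec2) →L[ℂ] C(Set.Icc (0 : ℝ) π, Vec2) => T w)
      hU.val_inv_mul
  have h2 : ∀ w, (1 - P.sysV z) (P.solveL z w) = w := fun w =>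
    congrArg (fun T : C(Set.Icc (0 : ℝ) π, Vec2) →L[ℂ] C(Set.Icc (0 : ℝ) π, Vec2) => T w)
      hU.mul_val_inv
  have h3 : ∀ w, (1 - P.sysV z) w = w - P.sysV z w := fun _ => rfl
  constructor
  · rintro rfl
    have := h2 f
    rw [h3] at this
    exact (sub_eq_iff_eq_add.1 this)
  · intro h
    have h4 : (1 - P.sysV z) u = f := by rw [h3]; exact sub_eq_iff_eq_add.2 h
    rw [← h4, h1]

lemma intervalIntegrable_rhs (z : ℂ) (u : C(Set.Icc (0 : ℝ) π, Vec2)) (g : Lp Vec2 2 P.wMeasure) :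
    IntervalIntegrable (fun t => P.coefMat z t (extendIcc u t)) volume 0 π ∧
    IntervalIntegrable (fun t => (P.rho t : ℂ) • matJ (g t)) volume 0 π := by
  constructor
  · rw [intervalIntegrable_iff_integrableOn_Ioo_of_le Real.pi_pos.le]
    exact (memLp_apply_extendIcc (P.memLp_coefMat z) u).integrable_two
  · exact P.intervalIntegrable_rho_smul
      (matJ.integrable_comp (Lp.memLp g).integrable_two)

/-- A function with `l(y) = z y + g` satisfies the Volterra integral equation. -/
lemma IsAC.toC_eq_solveL {y : ℝ → Vec2} (hy : IsAC y) {z : ℂ} {g : Lp Vec2 2 P.wMeasure}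
    (h : ∀ᵐ x ∂P.wMeasure, P.lExpr y x = z • y x + g x) :
    hy.toC = P.solveL z (ContinuousMap.const _ (y 0) + P.forcingL g) := by
  rw [eq_solveL_iff]
  ext1 x
  obtain ⟨h1, h2⟩ := P.intervalIntegrable_rhs z hy.toC g
  have hsub : Set.uIcc 0 (x : ℝ) ⊆ Set.uIcc 0 π := Set.uIcc_subset_uIcc_left (by
    rw [Set.uIcc_of_le Real.pi_pos.le]; exact x.2)
  simp only [ContinuousMap.add_apply, ContinuousMap.const_apply]
  rw [sysV, volterraL_apply, forcingL_apply, hy.toC_apply, hy.eq_add_integral_derivVec x.2,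
    add_assoc, ← intervalIntegral.integral_add (h2.mono_set hsub) (h1.mono_set hsub)]
  congr 1
  refine intervalIntegral.integral_congr_ae ?_
  rw [P.ae_wMeasure_iff, restrict_Ioo_eq_restrict_Ioc, ae_restrict_iff' measurableSet_Ioc] at h
  filter_upwards [h] with t ht htx
  rw [Set.uIoc_of_le x.2.1] at htx
  have htπ : t ∈ Set.Ioc 0 π := ⟨htx.1, htx.2.trans x.2.2⟩
  rw [(P.lExpr_eq_iff y z t _).1 (ht htπ), hy.extendIcc_toC (Set.Ioc_subset_Icc_self htπ), add_comm]

section Solve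

variable (z : ℂ) (v : Vec2) (g : Lp Vec2 2 P.wMeasure)

/-- The solution of `l(y) = z y + g`, `y(0) = v`. -/
def sol : C(Set.Icc (0 : ℝ) π, Vec2) := P.solveL z (ContinuousMap.const _ v + P.forcingL g)

lemma extendIcc_sol_eq_integral {x : ℝ} (hx : x ∈ Set.Icc 0 π) :
    extendIcc (P.sol z v g) x = v + ∫ t in (0 : ℝ)..x,
      (P.coefMat z t (extendIcc (P.sol z v g) t) + (P.rho t : ℂ) • matJ (g t)) := by
  have h := (P.eq_solveL_iff z (P.sol z v g) _).1 rfl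
  obtain ⟨h1, h2⟩ := P.intervalIntegrable_rhs z (P.sol z v g) g
  have hsub : Set.uIcc 0 x ⊆ Set.uIcc 0 π := Set.uIcc_subset_uIcc_left (by
    rw [Set.uIcc_of_le Real.pi_pos.le]; exact hx)
  rw [intervalIntegral.integral_add (h1.mono_set hsub) (h2.mono_set hsub),
    extendIcc_of_mem _ hx]
  have h' := congrArg (fun f : C(Set.Icc (0 : ℝ) π, Vec2) => f ⟨x, hx⟩) h
  simp only [ContinuousMap.add_apply, ContinuousMap.const_apply] at h'
  rw [h', sysV, volterraL_apply, forcingL_apply]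
  abel

lemma extendIcc_sol_zero : extendIcc (P.sol z v g) 0 = v := by
  rw [P.extendIcc_sol_eq_integral z v g (Set.left_mem_Icc.2 Real.pi_pos.le),
    intervalIntegral.integral_same, add_zero]

lemma isAC_sol : IsAC (extendIcc (P.sol z v g)) := by
  obtain ⟨h1, h2⟩ := P.intervalIntegrable_rhs z (P.sol z v g) g
  refine isAC_of_eq_integral (h1.add h2) fun x hx => ?_
  rw [P.extendIcc_sol_eq_integral z v g hx, extendIcc_sol_zero]

lemma lExpr_sol : ∀ᵐ x ∂P.wMeasure,
    P.lExpr (extendIcc (P.sol z v g)) x = z • extendIcc (P.sol z v g) x + g x := by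
  obtain ⟨h1, h2⟩ := P.intervalIntegrable_rhs z (P.sol z v g) g
  rw [ae_wMeasure_iff]
  filter_upwards [ae_derivVec_eq_of_eq_integral (h1.add h2) (y := extendIcc (P.sol z v g))
    fun x hx => by rw [P.extendIcc_sol_eq_integral z v g hx, extendIcc_sol_zero]] with x hx
  exact (P.lExpr_eq_iff _ _ _ _).2 hx

end Solve

lemma isSolution_iff (z : ℂ) (y : ℝ → Vec2) : P.IsSolution z y ↔
    IsAC y ∧ ∀ᵐ x ∂P.wMeasure, P.lExpr y x = z • y x := by
  rw [IsSolution, ae_wMeasure_iff]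
  refine and_congr_right fun _ => eventually_congr (Eventually.of_forall fun x => ?_)
  rw [lExpr, inv_smul_eq_iff₀ (P.rho_ofReal_ne_zero x), smul_smul, mul_comm]

variable {P} in
lemma IsSolution.isAC {z : ℂ} {y : ℝ → Vec2} (hy : P.IsSolution z y) : IsAC y := hy.1

lemma IsSolution.toC_eq_sol {z : ℂ} {y : ℝ → Vec2} (hy : P.IsSolution z y) :
    hy.isAC.toC = P.sol z (y 0) 0 := by
  refine hy.isAC.toC_eq_solveL P ?_
  filter_upwards [((P.isSolution_iff z y).1 hy).2, Lp.coeFn_zero Vec2 2 P.wMeasure] with x h1 h2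
  rw [h1, h2, Pi.zero_apply, add_zero]

lemma isSolution_sol (z : ℂ) (v : Vec2) : P.IsSolution z (extendIcc (P.sol z v 0)) := by
  rw [isSolution_iff]
  refine ⟨P.isAC_sol z v 0, ?_⟩
  filter_upwards [P.lExpr_sol z v 0, Lp.coeFn_zero Vec2 2 P.wMeasure] with x h1 h2
  rw [h1, h2, Pi.zero_apply, add_zero]

lemma phi_spec (z : ℂ) : P.IsSolution z (P.phi z) ∧ P.phi z 0 = !₂[0, -1] :=
  Classical.epsilon_spec (p := fun y : ℝ → Vec2 => P.IsSolution z y ∧ y 0 = !₂[0, -1])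
    ⟨extendIcc (P.sol z !₂[0, -1] 0), P.isSolution_sol z _, P.extendIcc_sol_zero z _ 0⟩

lemma isAC_phi (z : ℂ) : IsAC (P.phi z) := (P.phi_spec z).1.isAC

/-- The continuous function `φ(·, z)` on `[0, π]`. -/
def phiC (z : ℂ) : C(Set.Icc (0 : ℝ) π, Vec2) := (P.isAC_phi z).toC

lemma phiC_eq_sol (z : ℂ) : P.phiC z = P.sol z !₂[0, -1] 0 := by
  rw [phiC, (P.phi_spec z).1.toC_eq_sol, (P.phi_spec z).2]

end DiracProblem

end System

/-! ### The symmetric operator and its eigenvectors -/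

noncomputable section HilbertSpace

open scoped InnerProductSpace

namespace DiracProblem

/-- The right endpoint of `[0, π]`. -/
def ptPi : Set.Icc (0 : ℝ) π := ⟨π, Set.right_mem_Icc.2 Real.pi_pos.le⟩

/-- Lagrange's identity for two functions whose first component vanishes at `0`. -/
lemma integral_lagrange (P : DiracProblem) {y z : ℝ → Vec2} (hy : IsAC y) (hz : IsAC z)
    (hy0 : y 0 0 = 0) (hz0 : z 0 0 = 0) :
    ∫ x, (⟪z x, P.lExpr y x⟫_ℂ - ⟪P.lExpr z x, y x⟫_ℂ) ∂P.wMeasure =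
      y π 1 * conj (z π 0) - y π 0 * conj (z π 1) := by
  have hF : AbsolutelyContinuousOnInterval
      (fun t => y t 1 * conj (z t 0) - y t 0 * conj (z t 1)) 0 π :=
    ((hy 1).fun_smul (hz 0).star_comp).fun_sub ((hy 0).fun_smul (hz 1).star_comp)
  have h1 := hF.integral_deriv_eq_sub_complex
  rw [hy0, hz0, map_zero, mul_zero, zero_mul, sub_zero, sub_zero] at h1
  rw [← h1, P.integral_wMeasure]
  refine intervalIntegral.integral_congr_ae ?_
  filter_upwards [(hy 0).ae_hasDerivAt_complex, (hy 1).ae_hasDerivAt_complex,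
    (hz 0).ae_hasDerivAt_complex, (hz 1).ae_hasDerivAt_complex] with t a0 a1 b0 b1 ht
  have ht := Set.uIoc_subset_uIcc ht
  have c0 := (Complex.conjCLE.toContinuousLinearMap.hasFDerivAt).comp_hasDerivAt t (b0 ht)
  have c1 := (Complex.conjCLE.toContinuousLinearMap.hasFDerivAt).comp_hasDerivAt t (b1 ht)
  have hd := (((a1 ht).mul c0).sub ((a0 ht).mul c1)).deriv
  have hr := P.rho_ofReal_ne_zero t
  refine Eq.trans ?_ hd.symm
  simp only [PiLp.inner_apply, RCLike.inner_apply, Fin.sum_univ_two, lExpr, diracExpr,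
    PiLp.smul_apply, smul_eq_mul, Matrix.cons_val_zero, Matrix.cons_val_one, map_mul, map_add,
    map_sub, map_neg, map_inv₀, Complex.conj_ofReal, Function.comp_apply,
    ContinuousLinearEquiv.coe_coe, Complex.conjCLE_apply]
  field_simp
  ring

variable (P : DiracProblem)

/-- The Hilbert space `L_{2,ρ} ⊕ ℂ`; the scalar component is divided by `√h₂`, so that the
standard inner product of the `ℓ²` sum is that of the boundary value problem. -/
abbrev HSpace : Type := WithLp 2 (Lp Vec2 2 P.wMeasure × ℂ)

lemma sqrt_h₂_ne_zero : ((√P.h₂ : ℝ) : ℂ) ≠ 0 :=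
  Complex.ofReal_ne_zero.2 (Real.sqrt_pos.2 P.h₂_pos).ne'

lemma sqrt_h₂_mul_self : ((√P.h₂ : ℝ) : ℂ) * ((√P.h₂ : ℝ) : ℂ) = P.h₂ := by
  rw [← Complex.ofReal_mul, Real.mul_self_sqrt P.h₂_pos.le]

/-- The value at `π` of the component `i`. -/
def evalPi (i : Fin 2) : C(Set.Icc (0 : ℝ) π, Vec2) →L[ℂ] ℂ :=
  (EuclideanSpace.proj (𝕜 := ℂ) i : Vec2 →L[ℂ] ℂ).comp (ContinuousMap.evalCLM ℂ ptPi)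

/-- The embedding `y ↦ (y, y₁(π))` of `C[0, π]` into the Hilbert space. -/
def embL : C(Set.Icc (0 : ℝ) π, Vec2) →L[ℂ] P.HSpace :=
  (WithLp.prodContinuousLinearEquiv 2 ℂ (Lp Vec2 2 P.wMeasure) ℂ).symm.toContinuousLinearMap.comp
    ((mulL (memLp_const (ContinuousLinearMap.id ℂ Vec2))).prod
      (((√P.h₂ : ℝ) : ℂ)⁻¹ • evalPi 0))

lemma coeFn_embL_fst (u : C(Set.Icc (0 : ℝ) π, Vec2)) :
    (P.embL u).fst =ᵐ[P.wMeasure] extendIcc u :=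
  coeFn_mulL (memLp_const (ContinuousLinearMap.id ℂ Vec2)) u

lemma embL_snd (u : C(Set.Icc (0 : ℝ) π, Vec2)) :
    (P.embL u).snd = ((√P.h₂ : ℝ) : ℂ)⁻¹ * u ptPi 0 := rfl

lemma eq_of_extendIcc_ae_eq {u v : C(Set.Icc (0 : ℝ) π, Vec2)}
    (h : extendIcc u =ᵐ[P.wMeasure] extendIcc v) : u = v := by
  have h' : extendIcc u =ᵐ[volume.restrict (Set.Icc 0 π)] extendIcc v := by
    rw [← restrict_Ioo_eq_restrict_Icc]
    exact P.ae_wMeasure_iff.1 h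
  ext1 x
  have := Measure.eqOn_Icc_of_ae_eq volume Real.pi_pos.ne h' (continuous_extendIcc u).continuousOn
    (continuous_extendIcc v).continuousOn x.2
  rwa [extendIcc_of_mem _ x.2, extendIcc_of_mem _ x.2] at this

lemma embL_injective : Function.Injective P.embL := fun u v h =>
  P.eq_of_extendIcc_ae_eq ((P.coeFn_embL_fst u).symm.trans (h ▸ P.coeFn_embL_fst v))

/-- The relation `L (y, y₁(π)) = G` between an absolutely continuous function and an element of the
Hilbert space. -/
structure IsL (y : ℝ → Vec2) (G : P.HSpace) : Prop where
  ac : IsAC y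
  zero : y 0 0 = 0
  expr : ∀ᵐ x ∂P.wMeasure, P.lExpr y x = G.fst x
  bc : -P.h₁ * y π 0 - P.h₂ * y π 1 = ((√P.h₂ : ℝ) : ℂ) * G.snd

variable {P}

lemma inner_HSpace (F G : P.HSpace) : ⟪F, G⟫_ℂ = ⟪F.fst, G.fst⟫_ℂ + ⟪F.snd, G.snd⟫_ℂ := rfl

lemma coeFn_embL_toC {y : ℝ → Vec2} (hy : IsAC y) :
    (P.embL hy.toC).fst =ᵐ[P.wMeasure] y := by
  filter_upwards [P.coeFn_embL_fst hy.toC, P.ae_wMeasure_mem] with x h1 h2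
  rw [h1, hy.extendIcc_toC (Set.Ioo_subset_Icc_self h2)]

/-- The operator `L` is symmetric. -/
lemma IsL.inner_eq {y z : ℝ → Vec2} {G K : P.HSpace} (hy : P.IsL y G) (hz : P.IsL z K) :
    ⟪P.embL hz.ac.toC, G⟫_ℂ = ⟪K, P.embL hy.ac.toC⟫_ℂ := by
  have h1 := P.integral_lagrange hy.ac hz.ac hy.zero hz.zero
  have h2 : ⟪(P.embL hz.ac.toC).fst, G.fst⟫_ℂ - ⟪K.fst, (P.embL hy.ac.toC).fst⟫_ℂ =
      y π 1 * conj (z π 0) - y π 0 * conj (z π 1) := by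
    rw [← h1, L2.inner_def, L2.inner_def, ← integral_sub (L2.integrable_inner _ _)
      (L2.integrable_inner _ _)]
    refine integral_congr_ae ?_
    filter_upwards [hy.expr, hz.expr, coeFn_embL_toC hy.ac, coeFn_embL_toC hz.ac] with x a b c d
    rw [a, b, c, d]
  have hs := P.sqrt_h₂_ne_zero
  have hG : G.snd = ((√P.h₂ : ℝ) : ℂ)⁻¹ * (-P.h₁ * y π 0 - P.h₂ * y π 1) := by
    rw [hy.bc, inv_mul_cancel_left₀ hs]
  have hK : K.snd = ((√P.h₂ : ℝ) : ℂ)⁻¹ * (-P.h₁ * z π 0 - P.h₂ * z π 1) := by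
    rw [hz.bc, inv_mul_cancel_left₀ hs]
  have h3 : ⟪(P.embL hz.ac.toC).snd, G.snd⟫_ℂ - ⟪K.snd, (P.embL hy.ac.toC).snd⟫_ℂ =
      -(y π 1 * conj (z π 0) - y π 0 * conj (z π 1)) := by
    rw [hG, hK, embL_snd, embL_snd, show hz.ac.toC ptPi = z π from rfl,
      show hy.ac.toC ptPi = y π from rfl]
    simp only [RCLike.inner_apply, map_mul, map_sub, map_neg, map_inv₀, Complex.conj_ofReal]
    field_simp
    rw [sq, P.sqrt_h₂_mul_self]
    ring
  have h4 := congrArg₂ (· + ·) h2 h3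
  rw [← sub_eq_zero, inner_HSpace, inner_HSpace]
  linear_combination h4

variable (P)

/-- The solution `φ(·, z)` spans the solutions with vanishing first component at `0`. -/
lemma sol_eq_add_smul_phiC (z c : ℂ) (g : Lp Vec2 2 P.wMeasure) :
    P.sol z !₂[0, -c] g = P.solveL z (P.forcingL g) + c • P.phiC z := by
  have h : (ContinuousMap.const (Set.Icc (0 : ℝ) π) (!₂[0, -c] : Vec2)) =
      c • (ContinuousMap.const (Set.Icc (0 : ℝ) π) (!₂[0, -1] : Vec2)) := by
    ext x i
    fin_cases i <;> simp
  rw [phiC_eq_sol, sol, sol, h, map_zero, add_zero, map_add, map_smul, add_comm]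

lemma exists_eq_of_apply_zero {v : Vec2} (hv : v 0 = 0) : ∃ c : ℂ, v = !₂[0, -c] := by
  refine ⟨-v 1, ?_⟩
  ext i
  fin_cases i <;> simp [hv]

/-- The boundary form `(z + h₁) y₁(π) + h₂ y₂(π)`. -/
def bcL (z : ℂ) : C(Set.Icc (0 : ℝ) π, Vec2) →L[ℂ] ℂ :=
  (z + P.h₁) • evalPi 0 + (P.h₂ : ℂ) • evalPi 1

lemma bcL_apply (z : ℂ) (u : C(Set.Icc (0 : ℝ) π, Vec2)) :
    P.bcL z u = (z + P.h₁) * u ptPi 0 + P.h₂ * u ptPi 1 := rfl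

lemma isEigenvalue_iff (z : ℂ) : P.IsEigenvalue z ↔ P.bcL z (P.phiC z) = 0 := by
  constructor
  · rintro ⟨y, hy, ⟨x, hx, hyx⟩, h0, hbc⟩
    obtain ⟨c, hc⟩ := exists_eq_of_apply_zero h0
    have h1 := hy.toC_eq_sol
    rw [hc, P.sol_eq_add_smul_phiC z c, map_zero, map_zero, zero_add] at h1
    have h2 : c ≠ 0 := by
      rintro rfl
      have h4 : y x = (0 : ℂ) • P.phiC z ⟨x, hx⟩ :=
        congrArg (fun u : C(Set.Icc (0 : ℝ) π, Vec2) => u ⟨x, hx⟩) h1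
      exact hyx (h4.trans (zero_smul ℂ _))
    have h3 : P.bcL z (hy.isAC.toC) = 0 := hbc
    rw [h1, map_smul, smul_eq_mul] at h3
    exact (mul_eq_zero.1 h3).resolve_left h2
  · intro h
    refine ⟨P.phi z, (P.phi_spec z).1, ⟨0, Set.left_mem_Icc.2 Real.pi_pos.le, ?_⟩, ?_, h⟩
    · rw [(P.phi_spec z).2]
      intro h
      simpa using congrArg (fun v : Vec2 => v 1) h
    · rw [(P.phi_spec z).2]
      rfl

lemma phiC_ne_zero (z : ℂ) : P.phiC z ≠ 0 := by
  intro h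
  have h1 : P.phi z 0 = 0 := congrArg (fun u : C(Set.Icc (0 : ℝ) π, Vec2) =>
    u ⟨0, Set.left_mem_Icc.2 Real.pi_pos.le⟩) h
  rw [(P.phi_spec z).2] at h1
  simpa using congrArg (fun v : Vec2 => v 1) h1

/-- The eigenvector `(φ(·, z), φ₁(π, z))` in the Hilbert space. -/
def eigvec (z : ℂ) : P.HSpace := P.embL (P.phiC z)

lemma eigvec_ne_zero (z : ℂ) : P.eigvec z ≠ 0 := fun h =>
  P.phiC_ne_zero z (P.embL_injective (h.trans (map_zero _).symm))

lemma isL_phi {z : ℂ} (hz : P.IsEigenvalue z) : P.IsL (P.phi z) (z • P.eigvec z) where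
  ac := P.isAC_phi z
  zero := by rw [(P.phi_spec z).2]; rfl
  expr := by
    filter_upwards [((P.isSolution_iff z _).1 (P.phi_spec z).1).2,
      coeFn_embL_toC (P := P) (P.isAC_phi z), Lp.coeFn_smul z (P.eigvec z).fst] with x h1 h2 h3
    rw [h1, WithLp.smul_fst, h3, Pi.smul_apply, ← h2]
    rfl
  bc := by
    have h := (P.isEigenvalue_iff z).1 hz
    rw [bcL_apply] at h
    rw [WithLp.smul_snd, eigvec, embL_snd, smul_eq_mul, mul_left_comm,
      mul_inv_cancel_left₀ P.sqrt_h₂_ne_zero]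
    change (z + P.h₁) * P.phi z π 0 + P.h₂ * P.phi z π 1 = 0 at h
    change _ = z * P.phi z π 0
    linear_combination -h

lemma inner_eigvec_mul {z w : ℂ} (hz : P.IsEigenvalue z) (hw : P.IsEigenvalue w) :
    (z - conj w) * ⟪P.eigvec w, P.eigvec z⟫_ℂ = 0 := by
  have h := (P.isL_phi hz).inner_eq (P.isL_phi hw)
  change ⟪P.eigvec w, z • P.eigvec z⟫_ℂ = ⟪w • P.eigvec w, P.eigvec z⟫_ℂ at h
  rw [inner_smul_left, inner_smul_right] at h
  linear_combination h

lemma IsEigenvalue.conj_eq {P : DiracProblem} {z : ℂ} (hz : P.IsEigenvalue z) : conj z = z := by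
  have h := (mul_eq_zero.1 (P.inner_eigvec_mul hz hz)).resolve_right
    (inner_self_ne_zero.2 (P.eigvec_ne_zero z))
  exact (sub_eq_zero.1 h).symm

lemma inner_eigvec_eq_zero {z w : ℂ} (hz : P.IsEigenvalue z) (hw : P.IsEigenvalue w)
    (h : z ≠ w) : ⟪P.eigvec w, P.eigvec z⟫_ℂ = 0 := by
  refine (mul_eq_zero.1 (P.inner_eigvec_mul hz hw)).resolve_left ?_
  rw [hw.conj_eq]
  exact sub_ne_zero.2 h

/-- There are at most countably many eigenvalues, since eigenvectors of different eigenvalues are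
orthogonal and the Hilbert space is separable. -/
lemma countable_eigenvalues : {z : ℂ | P.IsEigenvalue z}.Countable := by
  -- the balls of radius `1/2` about the normalized eigenvectors are disjoint
  let e : ℂ → P.HSpace := fun z => ((‖P.eigvec z‖⁻¹ : ℝ) : ℂ) • P.eigvec z
  have he : ∀ z, ‖e z‖ = 1 := fun z => by
    rw [norm_smul, Complex.norm_real, norm_inv, norm_norm,
      inv_mul_cancel₀ (norm_ne_zero_iff.2 (P.eigvec_ne_zero z))]
  have : TopologicalSpace.SeparableSpace P.HSpace := by
    have : Fact ((2 : ℝ≥0∞) ≠ ⊤) := ⟨by norm_num⟩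
    infer_instance
  refine Set.PairwiseDisjoint.countable_of_isOpen (s := fun z => Metric.ball (e z) (1 / 2)) ?_
    (fun _ _ => Metric.isOpen_ball) (fun z _ => ⟨e z, Metric.mem_ball_self (by norm_num)⟩)
  intro z hz w hw hzw
  refine Metric.ball_disjoint_ball ?_
  have h0 : ⟪e z, e w⟫_ℂ = 0 := by
    rw [inner_smul_left, inner_smul_right, P.inner_eigvec_eq_zero hw hz hzw.symm, mul_zero,
      mul_zero]
  have h1 := norm_sub_sq (𝕜 := ℂ) (e z) (e w)
  rw [h0, he, he, map_zero] at h1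
  rw [dist_eq_norm]
  nlinarith [norm_nonneg (e z - e w)]

lemma exists_real_not_isEigenvalue : ∃ μ : ℝ, ¬P.IsEigenvalue μ := by
  by_contra! h
  have h1 : (Set.univ : Set ℝ).Countable :=
    (P.countable_eigenvalues.preimage Complex.ofReal_injective).mono fun x _ => h x
  exact Cardinal.not_countable_real h1

end DiracProblem

end HilbertSpace

/-! ### The resolvent and the spectral theorem -/

noncomputable section Resolvent

open scoped InnerProductSpace

namespace DiracProblem

variable (P : DiracProblem)

/-- The solution of `l(y) = z y + G`, `y(0) = 0`, as a function of `G`. -/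
def particularL (z : ℂ) : P.HSpace →L[ℂ] C(Set.Icc (0 : ℝ) π, Vec2) :=
  (P.solveL z).comp (P.forcingL.comp (WithLp.fstL 2 ℂ (Lp Vec2 2 P.wMeasure) ℂ))

/-- The multiple of `φ(·, z)` that has to be added to the particular solution in order to satisfy
the boundary condition at `π`. -/
def correctionL (z : ℂ) : P.HSpace →L[ℂ] ℂ :=
  (-(P.bcL z (P.phiC z))⁻¹) • ((P.bcL z).comp (P.particularL z) +
    ((√P.h₂ : ℝ) : ℂ) • WithLp.sndL 2 ℂ (Lp Vec2 2 P.wMeasure) ℂ)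

/-- The resolvent `(L - z)⁻¹`, with values in `C[0, π]`. -/
def resolventL (z : ℂ) : P.HSpace →L[ℂ] C(Set.Icc (0 : ℝ) π, Vec2) :=
  P.particularL z +
    (ContinuousLinearMap.toSpanSingleton ℂ (P.phiC z)).comp (P.correctionL z)

lemma resolventL_apply (z : ℂ) (G : P.HSpace) :
    P.resolventL z G = P.particularL z G + P.correctionL z G • P.phiC z := rfl

lemma isCompactOperator_resolventL (z : ℂ) : IsCompactOperator (P.resolventL z) := by
  refine IsCompactOperator.add ?_ ?_
  · exact (P.isCompactOperator_forcingL.comp_clm _).clm_comp (P.solveL z)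
  · exact (isCompactOperator_of_locallyCompactSpace_rng
      (ContinuousLinearMap.toSpanSingleton ℂ (P.phiC z))).comp_clm (P.correctionL z)

lemma resolventL_eq_sol (z : ℂ) (G : P.HSpace) :
    P.resolventL z G = P.sol z !₂[0, -P.correctionL z G] G.fst := by
  rw [sol_eq_add_smul_phiC, resolventL_apply]
  rfl

variable {P}

lemma bcL_resolventL {z : ℂ} (hz : ¬P.IsEigenvalue z) (G : P.HSpace) :
    P.bcL z (P.resolventL z G) = -(((√P.h₂ : ℝ) : ℂ) * G.snd) := by
  rw [isEigenvalue_iff] at hz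
  have h : P.correctionL z G = -(P.bcL z (P.phiC z))⁻¹ *
    (P.bcL z (P.particularL z G) + ((√P.h₂ : ℝ) : ℂ) * G.snd) := rfl
  rw [resolventL_apply, map_add, map_smul, h, smul_eq_mul]
  field_simp
  ring

/-- The resolvent solves `L y = z y + G`. -/
lemma isL_resolventL {z : ℂ} (hz : ¬P.IsEigenvalue z) (G : P.HSpace) :
    P.IsL (extendIcc (P.resolventL z G)) (z • P.embL (P.resolventL z G) + G) where
  ac := by rw [resolventL_eq_sol]; exact P.isAC_sol _ _ _
  zero := by rw [resolventL_eq_sol, extendIcc_sol_zero]; rfl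
  expr := by
    have h := P.lExpr_sol z !₂[0, -P.correctionL z G] G.fst
    rw [← resolventL_eq_sol] at h
    filter_upwards [h, P.coeFn_embL_fst (P.resolventL z G),
      Lp.coeFn_smul z (P.embL (P.resolventL z G)).fst,
      Lp.coeFn_add (z • P.embL (P.resolventL z G)).fst G.fst] with x h1 h2 h3 h4
    rw [WithLp.add_fst, h4, Pi.add_apply, WithLp.smul_fst, h3, Pi.smul_apply, h2, h1]
  bc := by
    have h := bcL_resolventL hz G
    have hπ : ∀ u : C(Set.Icc (0 : ℝ) π, Vec2), extendIcc u π = u ptPi := fun u =>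
      extendIcc_of_mem u ptPi.2
    rw [bcL_apply] at h
    rw [hπ, WithLp.add_snd, WithLp.smul_snd, embL_snd, smul_eq_mul, mul_add, mul_left_comm,
      mul_inv_cancel_left₀ P.sqrt_h₂_ne_zero]
    linear_combination -h

/-- The equation `L y = z y + G` has no other solution. -/
lemma IsL.toC_eq_resolventL {z : ℂ} (hz : ¬P.IsEigenvalue z) {y : ℝ → Vec2} {G : P.HSpace}
    (hy : IsAC y) (h : P.IsL y (z • P.embL hy.toC + G)) : hy.toC = P.resolventL z G := by
  obtain ⟨c, hc⟩ := exists_eq_of_apply_zero h.zero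
  have h1 : hy.toC = P.sol z !₂[0, -c] G.fst := by
    rw [← hc]
    refine hy.toC_eq_solveL P ?_
    filter_upwards [h.expr, coeFn_embL_toC (P := P) hy, Lp.coeFn_smul z (P.embL hy.toC).fst,
      Lp.coeFn_add (z • P.embL hy.toC).fst G.fst] with x h1 h2 h3 h4
    rw [h1, WithLp.add_fst, h4, Pi.add_apply, WithLp.smul_fst, h3, Pi.smul_apply, h2]
  rw [sol_eq_add_smul_phiC] at h1
  have h2 : P.bcL z hy.toC = -(((√P.h₂ : ℝ) : ℂ) * G.snd) := by
    have hb := h.bc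
    rw [WithLp.add_snd, WithLp.smul_snd, embL_snd, smul_eq_mul, mul_add, mul_left_comm,
      mul_inv_cancel_left₀ P.sqrt_h₂_ne_zero] at hb
    rw [bcL_apply]
    rw [hy.toC_apply, show ((ptPi : Set.Icc (0 : ℝ) π) : ℝ) = π from rfl] at hb ⊢
    linear_combination -hb
  have h3 := bcL_resolventL hz G
  rw [← h2, h1, resolventL_apply, map_add, map_add, map_smul, map_smul] at h3
  have h4 : P.correctionL z G = c := by
    rw [isEigenvalue_iff] at hz
    refine mul_right_cancel₀ hz ?_
    exact add_left_cancel h3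
  rw [h1, resolventL_apply, h4]
  rfl

/-- An element of `C[0, π]` is the restriction of its extension. -/
lemma toC_extendIcc {u : C(Set.Icc (0 : ℝ) π, Vec2)} (hu : IsAC (extendIcc u)) : hu.toC = u := by
  ext1 x
  rw [hu.toC_apply, extendIcc_of_mem _ x.2]

variable (P)

/-- The resolvent `(L - z)⁻¹` as an operator of the Hilbert space. -/
def resolventH (z : ℂ) : P.HSpace →L[ℂ] P.HSpace := P.embL.comp (P.resolventL z)

lemma resolventH_apply (z : ℂ) (G : P.HSpace) :
    P.resolventH z G = P.embL (P.resolventL z G) := rfl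

lemma isCompactOperator_resolventH (z : ℂ) : IsCompactOperator (P.resolventH z) :=
  (P.isCompactOperator_resolventL z).clm_comp P.embL

variable {P}

lemma isSymmetric_resolventH {μ : ℝ} (hμ : ¬P.IsEigenvalue μ) :
    (P.resolventH μ : P.HSpace →ₗ[ℂ] P.HSpace).IsSymmetric := by
  intro K G
  have hy := isL_resolventL hμ G
  have hz := isL_resolventL hμ K
  have h := hy.inner_eq hz
  rw [toC_extendIcc, toC_extendIcc, inner_add_left, inner_add_right, inner_smul_left,
    inner_smul_right, Complex.conj_ofReal] at h
  exact add_left_cancel h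

lemma resolventH_injective {z : ℂ} (hz : ¬P.IsEigenvalue z) :
    Function.Injective (P.resolventH z) := by
  rw [injective_iff_map_eq_zero]
  intro G hG
  have h0 : P.resolventL z G = 0 := P.embL_injective (hG.trans (map_zero _).symm)
  have h := isL_resolventL hz G
  rw [h0, map_zero, smul_zero, zero_add] at h
  have hext : ∀ t, extendIcc (0 : C(Set.Icc (0 : ℝ) π, Vec2)) t = 0 := fun t => rfl
  have h1 : G.fst = 0 := by
    rw [Lp.eq_zero_iff_ae_eq_zero]
    filter_upwards [h.expr] with x hx
    rw [← hx]
    have : P.diracExpr (extendIcc (0 : C(Set.Icc (0 : ℝ) π, Vec2))) x = 0 := by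
      ext i
      fin_cases i <;> simp [diracExpr, hext]
    rw [lExpr, this, smul_zero]
    rfl
  have h2 : G.snd = 0 := by
    have := h.bc
    simp only [hext] at this
    refine (mul_eq_zero.1 (Eq.trans this.symm ?_)).resolve_left P.sqrt_h₂_ne_zero
    simp
  exact (WithLp.ofLp_injective 2) (Prod.ext h1 h2)

/-- The vector `(0, 1)` is not in the range of the resolvent, whose elements are of the form
`(y, y₁(π))` with continuous `y`. -/
lemma resolventH_not_surjective (z : ℂ) : ¬Function.Surjective (P.resolventH z) := by
  intro h
  obtain ⟨G, hG⟩ := h (WithLp.toLp 2 (0, 1))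
  have h1 : P.resolventL z G = 0 := by
    apply P.eq_of_extendIcc_ae_eq
    have h2 := P.coeFn_embL_fst (P.resolventL z G)
    rw [← resolventH_apply, hG] at h2
    exact h2.symm.trans (Lp.coeFn_zero Vec2 2 P.wMeasure)
  have h3 := congrArg WithLp.snd hG
  rw [resolventH_apply, h1, map_zero] at h3
  exact zero_ne_one h3

/-- On an eigenvector of `L`, the resolvent is division by `λ - z`. -/
lemma resolventL_eigvec {z w : ℂ} (hz : ¬P.IsEigenvalue z) (hw : P.IsEigenvalue w) :
    (w - z) • P.resolventL z (P.eigvec w) = P.phiC w := by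
  rw [← map_smul]
  refine (IsL.toC_eq_resolventL hz (P.isAC_phi w) ?_).symm
  have h := P.isL_phi hw
  convert h using 1
  change z • P.eigvec w + (w - z) • P.eigvec w = _
  rw [← add_smul, add_sub_cancel]

/-- An eigenvector of the resolvent with eigenvalue `ν ≠ 0` is proportional to the eigenvector of `L`
with eigenvalue `z + 1/ν`. -/
lemma mem_span_eigvec_of_resolventH_eq {z ν : ℂ} (hz : ¬P.IsEigenvalue z) {G : P.HSpace}
    (hν : ν ≠ 0) (hG : P.resolventH z G = ν • G) :
    G ∈ Submodule.span ℂ (P.eigvec '' {w | P.IsEigenvalue w}) := by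
  rcases eq_or_ne G 0 with rfl | hG0
  · exact zero_mem _
  have h := isL_resolventL hz G
  set u := P.resolventL z G with hu
  have hG' : G = ν⁻¹ • P.embL u := by
    rw [← resolventH_apply, hG, smul_smul, inv_mul_cancel₀ hν, one_smul]
  rw [show z • P.embL u + G = (z + ν⁻¹) • P.embL u by rw [add_smul, ← hG']] at h
  obtain ⟨c, hc⟩ := exists_eq_of_apply_zero h.zero
  have h1 : u = c • P.phiC (z + ν⁻¹) := by
    have h2 : h.ac.toC = P.sol (z + ν⁻¹) !₂[0, -c] 0 := by
      rw [← hc]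
      refine h.ac.toC_eq_solveL P ?_
      filter_upwards [h.expr, P.coeFn_embL_fst u, Lp.coeFn_smul (z + ν⁻¹) (P.embL u).fst,
        Lp.coeFn_zero Vec2 2 P.wMeasure] with x h1 h2 h3 h4
      rw [h1, WithLp.smul_fst, h3, Pi.smul_apply, h2, h4, Pi.zero_apply, add_zero]
    rwa [toC_extendIcc, sol_eq_add_smul_phiC, map_zero, map_zero, zero_add] at h2
  have hG2 : G = (ν⁻¹ * c) • P.eigvec (z + ν⁻¹) := by
    rw [hG', h1, map_smul, smul_smul]; rfl
  have hc0 : c ≠ 0 := by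
    rintro rfl
    rw [mul_zero, zero_smul] at hG2
    exact hG0 hG2
  have hw : P.IsEigenvalue (z + ν⁻¹) := by
    rw [isEigenvalue_iff]
    have hb := h.bc
    have hπ : extendIcc u π = u ptPi := extendIcc_of_mem u ptPi.2
    rw [hπ, WithLp.smul_snd, embL_snd, smul_eq_mul, mul_left_comm,
      mul_inv_cancel_left₀ P.sqrt_h₂_ne_zero] at hb
    have h3 : P.bcL (z + ν⁻¹) u = 0 := by
      rw [bcL_apply]
      linear_combination -hb
    rw [h1, map_smul, smul_eq_mul] at h3
    exact (mul_eq_zero.1 h3).resolve_left hc0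
  rw [hG2]
  exact Submodule.smul_mem _ _ (Submodule.subset_span ⟨_, hw, rfl⟩)

variable (P)

/-- The eigenvectors of `L` are complete in the Hilbert space. -/
lemma orthogonal_span_eigvec_eq_bot :
    (Submodule.span ℂ (P.eigvec '' {w | P.IsEigenvalue w}))ᗮ = ⊥ := by
  obtain ⟨μ, hμ⟩ := P.exists_real_not_isEigenvalue
  rw [eq_bot_iff, ← ContinuousLinearMap.orthogonalComplement_iSup_eigenspaces_eq_bot
    (P.isCompactOperator_resolventH μ) (isSymmetric_resolventH hμ)]
  refine Submodule.orthogonal_le (iSup_le fun ν G hG => ?_)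
  have hG' : P.resolventH μ G = ν • G := Module.End.mem_eigenspace_iff.1 hG
  -- the kernel of the resolvent is trivial, so only `ν ≠ 0` contributes
  rcases eq_or_ne ν 0 with rfl | hν
  · rw [zero_smul] at hG'
    rw [resolventH_injective hμ (hG'.trans (map_zero _).symm)]
    exact zero_mem _
  · exact mem_span_eigvec_of_resolventH_eq hμ hν hG'

/-- With finitely many eigenvalues the space would be finite-dimensional, and the injective resolvent
surjective. -/
lemma infinite_eigenvalues : {z : ℂ | P.IsEigenvalue z}.Infinite := by
  intro hfin
  obtain ⟨μ, hμ⟩ := P.exists_real_not_isEigenvalue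
  have h1 := P.orthogonal_span_eigvec_eq_bot
  have hfd : FiniteDimensional ℂ (Submodule.span ℂ (P.eigvec '' {w | P.IsEigenvalue w})) :=
    FiniteDimensional.span_of_finite ℂ (hfin.image _)
  rw [Submodule.orthogonal_eq_bot_iff] at h1
  rw [h1] at hfd
  have : FiniteDimensional ℂ P.HSpace :=
    Module.finite_def.2 ((Submodule.fg_top _).1 (Module.finite_def.1 hfd))
  exact resolventH_not_surjective (P := P) μ
    (LinearMap.injective_iff_surjective (f := (P.resolventH μ : P.HSpace →ₗ[ℂ] P.HSpace)).1
      (resolventH_injective hμ))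

lemma exists_isEigenvalueEnumeration : ∃ e : ℤ → ℝ, P.IsEigenvalueEnumeration e := by
  have : Countable {z : ℂ | P.IsEigenvalue z} := P.countable_eigenvalues.to_subtype
  have : Infinite {z : ℂ | P.IsEigenvalue z} := P.infinite_eigenvalues.to_subtype
  obtain ⟨f⟩ : Nonempty (ℤ ≃ {z : ℂ | P.IsEigenvalue z}) := nonempty_equiv_of_countable
  have hre : ∀ n, (((f n : ℂ).re : ℝ) : ℂ) = f n := fun n =>
    Complex.conj_eq_iff_re.1 (f n).2.conj_eq
  refine ⟨fun n => (f n : ℂ).re, fun m n h => f.injective (Subtype.ext ?_), ?_⟩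
  · rw [← hre m, ← hre n]
    exact congrArg _ h
  · simp only [hre]
    exact (f.surjective.range_comp Subtype.val).trans Subtype.range_coe

end DiracProblem

end Resolvent

/-! ### Eigenfunction expansions -/

noncomputable section Expansion

open scoped InnerProductSpace

namespace DiracProblem

variable {P : DiracProblem}

/-- The element of the Hilbert space represented by a pair. -/
def toH {Y : (ℝ → Vec2) × ℂ} (hY : P.MemH Y) : P.HSpace :=
  WithLp.toLp 2 (MemLp.toLp Y.1 hY, ((√P.h₂ : ℝ) : ℂ)⁻¹ * Y.2)

lemma coeFn_toH_fst {Y : (ℝ → Vec2) × ℂ} (hY : P.MemH Y) : (toH hY).fst =ᵐ[P.wMeasure] Y.1 :=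
  MemLp.coeFn_toLp hY

lemma toH_snd {Y : (ℝ → Vec2) × ℂ} (hY : P.MemH Y) :
    (toH hY).snd = ((√P.h₂ : ℝ) : ℂ)⁻¹ * Y.2 := rfl

lemma inner_toH {Y Z : (ℝ → Vec2) × ℂ} (hY : P.MemH Y) (hZ : P.MemH Z) :
    ⟪toH hZ, toH hY⟫_ℂ = P.innerH Y Z := by
  rw [inner_HSpace, innerH, L2.inner_def]
  congr 1
  · refine integral_congr_ae ?_
    filter_upwards [coeFn_toH_fst hY, coeFn_toH_fst hZ] with x h1 h2
    rw [h1, h2, PiLp.inner_apply, Fin.sum_univ_two]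
    rfl
  · rw [toH_snd, toH_snd, RCLike.inner_apply, map_mul, map_inv₀, Complex.conj_ofReal,
      ← P.sqrt_h₂_mul_self]
    have := P.sqrt_h₂_ne_zero
    field_simp

lemma norm_toH_sq {Y : (ℝ → Vec2) × ℂ} (hY : P.MemH Y) : ‖toH hY‖ ^ 2 = P.normSqH Y := by
  have h1 : ((‖toH hY‖ ^ 2 : ℝ) : ℂ) = P.innerH Y Y := by
    rw [← inner_toH hY hY, inner_self_eq_norm_sq_to_K]
    norm_cast
  have h2 : P.innerH Y Y = ((P.normSqH Y : ℝ) : ℂ) := by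
    rw [innerH, normSqH, Complex.ofReal_add, ← integral_complex_ofReal]
    simp only [Complex.mul_conj, Complex.normSq_eq_norm_sq]
    push_cast
    rfl
  exact_mod_cast h1.trans h2

lemma memH_of_isAC {y : ℝ → Vec2} (hy : IsAC y) (c : ℂ) : P.MemH (y, c) :=
  (memLp_congr_ae (coeFn_embL_toC (P := P) hy)).1 (Lp.memLp _)

lemma toH_of_isAC {y : ℝ → Vec2} (hy : IsAC y) {Y : (ℝ → Vec2) × ℂ} (hY : P.MemH Y)
    (h1 : Y.1 = y) (h2 : Y.2 = y π 0) : toH hY = P.embL hy.toC := by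
  subst h1
  refine WithLp.ofLp_injective 2 (Prod.ext ?_ ?_)
  · exact Lp.ext ((coeFn_toH_fst hY).trans (coeFn_embL_toC (P := P) hy).symm)
  · change (toH hY).snd = (P.embL hy.toC).snd
    rw [toH_snd, embL_snd, h2]
    rfl

lemma memH_eigenvector (z : ℂ) : P.MemH (P.eigenvector z) := memH_of_isAC (P.isAC_phi z) _

lemma toH_eigenvector (z : ℂ) : toH (P.memH_eigenvector z) = P.eigvec z :=
  toH_of_isAC (P.isAC_phi z) _ rfl rfl

lemma normalizing_eq (z : ℂ) : P.normalizing z = ‖P.eigvec z‖ ^ 2 := by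
  rw [← toH_eigenvector, norm_toH_sq, normalizing]

lemma coeff_eq {Y : (ℝ → Vec2) × ℂ} (hY : P.MemH Y) (z : ℂ) :
    P.coeff Y z = ⟪P.eigvec z, toH hY⟫_ℂ / ((‖P.eigvec z‖ ^ 2 : ℝ) : ℂ) := by
  rw [coeff, normalizing_eq, ← inner_toH hY (P.memH_eigenvector z), toH_eigenvector]

variable {e : ℤ → ℝ}

lemma IsEigenvalueEnumeration.isEigenvalue (he : P.IsEigenvalueEnumeration e) (n : ℤ) :
    P.IsEigenvalue (e n) :=
  he.2.subset ⟨n, rfl⟩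

/-- The normalized eigenvectors form a Hilbert basis. -/
lemma IsEigenvalueEnumeration.exists_hilbertBasis (he : P.IsEigenvalueEnumeration e) :
    ∃ b : HilbertBasis ℤ ℂ P.HSpace,
      ∀ n, b n = ((‖P.eigvec (e n)‖⁻¹ : ℝ) : ℂ) • P.eigvec (e n) := by
  have hne : ∀ n, ((‖P.eigvec (e n)‖⁻¹ : ℝ) : ℂ) ≠ 0 := fun n => by
    have := norm_ne_zero_iff.2 (P.eigvec_ne_zero (e n))
    exact_mod_cast inv_ne_zero this
  have ho : Orthonormal ℂ fun n => ((‖P.eigvec (e n)‖⁻¹ : ℝ) : ℂ) • P.eigvec (e n) := by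
    refine ⟨fun n => ?_, fun m n hmn => ?_⟩
    · rw [norm_smul, Complex.norm_real, norm_inv, norm_norm,
        inv_mul_cancel₀ (norm_ne_zero_iff.2 (P.eigvec_ne_zero _))]
    · change ⟪_, _⟫_ℂ = 0
      rw [inner_smul_left, inner_smul_right, P.inner_eigvec_eq_zero (he.isEigenvalue n)
        (he.isEigenvalue m) (fun h => hmn (he.1 (Complex.ofReal_injective h)).symm), mul_zero,
        mul_zero]
  refine ⟨HilbertBasis.mkOfOrthogonalEqBot ho ?_, fun n => by
    rw [HilbertBasis.coe_mkOfOrthogonalEqBot]⟩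
  rw [eq_bot_iff, ← P.orthogonal_span_eigvec_eq_bot]
  refine Submodule.orthogonal_le (Submodule.span_le.2 ?_)
  rintro _ ⟨w, hw, rfl⟩
  obtain ⟨n, rfl⟩ := he.2.symm.subset hw
  have h1 := Submodule.smul_mem _ ((‖P.eigvec (e n)‖⁻¹ : ℝ) : ℂ)⁻¹ (Submodule.subset_span
    (R := ℂ) (Set.mem_range_self (f := fun n => ((‖P.eigvec (e n)‖⁻¹ : ℝ) : ℂ) • P.eigvec (e n)) n))
  rwa [inv_smul_smul₀ (hne n)] at h1

/-- Expansion of an element of the Hilbert space in eigenvectors. -/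
lemma IsEigenvalueEnumeration.hasSum_eigvec (he : P.IsEigenvalueEnumeration e) (G : P.HSpace) :
    HasSum (fun n => (⟪P.eigvec (e n), G⟫_ℂ / ((‖P.eigvec (e n)‖ ^ 2 : ℝ) : ℂ)) • P.eigvec (e n))
      G := by
  obtain ⟨b, hb⟩ := he.exists_hilbertBasis
  have hterm : (fun n => (⟪P.eigvec (e n), G⟫_ℂ / ((‖P.eigvec (e n)‖ ^ 2 : ℝ) : ℂ)) •
      P.eigvec (e n)) = fun n => b.repr G n • b n := by
    funext n
    rw [b.repr_apply_apply, hb, inner_smul_left, smul_smul, Complex.conj_ofReal]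
    congr 1
    push_cast
    ring
  rw [hterm]
  exact b.hasSum_repr G

/-- The Parseval equality in the Hilbert space. -/
lemma IsEigenvalueEnumeration.hasSum_parseval (he : P.IsEigenvalueEnumeration e) (G : P.HSpace) :
    HasSum (fun n => ‖P.eigvec (e n)‖ ^ 2 *
      ‖⟪P.eigvec (e n), G⟫_ℂ / ((‖P.eigvec (e n)‖ ^ 2 : ℝ) : ℂ)‖ ^ 2) (‖G‖ ^ 2) := by
  obtain ⟨b, hb⟩ := he.exists_hilbertBasis
  have h := b.hasSum_inner_mul_inner G G
  have h1 : ∀ n, ⟪G, b n⟫_ℂ * ⟪b n, G⟫_ℂ = ((‖⟪b n, G⟫_ℂ‖ ^ 2 : ℝ) : ℂ) := fun n => by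
    rw [← inner_conj_symm, mul_comm, Complex.mul_conj, Complex.normSq_eq_norm_sq]
  simp only [h1] at h
  rw [inner_self_eq_norm_sq_to_K] at h
  have h2 : HasSum (fun n => ‖⟪b n, G⟫_ℂ‖ ^ 2) (‖G‖ ^ 2) := by
    rw [← Complex.hasSum_ofReal, Complex.ofReal_pow]
    exact h
  convert h2 using 2 with n
  have hne := norm_ne_zero_iff.2 (P.eigvec_ne_zero (e n))
  rw [hb, inner_smul_left, norm_mul, Complex.conj_ofReal, norm_div, Complex.norm_real,
    Complex.norm_real, norm_inv, norm_pow, norm_norm]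
  field_simp

lemma sum_smul_eigvec (c : ℤ → ℂ) (s : Finset ℤ) :
    ∑ n ∈ s, c n • P.eigvec (e n) = P.embL (∑ n ∈ s, c n • P.phiC (e n)) := by
  rw [map_sum]
  exact Finset.sum_congr rfl fun n _ => (map_smul _ _ _).symm

lemma coeFn_fst_sum_smul_eigvec (c : ℤ → ℂ) (s : Finset ℤ) :
    (∑ n ∈ s, c n • P.eigvec (e n)).fst =ᵐ[P.wMeasure] fun x => ∑ n ∈ s, c n • P.phi (e n) x := by
  rw [sum_smul_eigvec]
  filter_upwards [P.coeFn_embL_fst (∑ n ∈ s, c n • P.phiC (e n)), P.ae_wMeasure_mem] with x h1 h2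
  rw [h1, extendIcc_of_mem _ (Set.Ioo_subset_Icc_self h2), ContinuousMap.sum_apply]
  rfl

/-- Convergence in `L_{2,ρ}` of the function component of the expansion. -/
lemma IsEigenvalueEnumeration.tendsto_eLpNorm (he : P.IsEigenvalueEnumeration e)
    {Y : (ℝ → Vec2) × ℂ} (hY : P.MemH Y) :
    Tendsto (fun s : Finset ℤ => eLpNorm
      (fun x => Y.1 x - ∑ n ∈ s, P.coeff Y (e n) • P.phi (e n) x) 2 P.wMeasure) atTop (𝓝 0) := by
  have h := ((WithLp.fstL 2 ℂ (Lp Vec2 2 P.wMeasure) ℂ).continuous.tendsto _).comp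
    (he.hasSum_eigvec (toH hY))
  have h' := (Lp.tendsto_Lp_iff_tendsto_eLpNorm' _ _).1 h
  refine h'.congr fun s => ?_
  rw [← eLpNorm_neg]
  refine eLpNorm_congr_ae ?_
  filter_upwards [coeFn_toH_fst hY, coeFn_fst_sum_smul_eigvec (P := P) (e := e)
    (fun n => P.coeff Y (e n)) s] with x h1 h2
  simp only [coeff_eq hY] at h2 ⊢
  simp only [Pi.neg_apply, Pi.sub_apply, Function.comp_apply, WithLp.fstL_apply, neg_sub]
  rw [h1, h2]

/-- Density of the span of the eigenfunctions in `L_{2,ρ}`. -/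
lemma IsEigenvalueEnumeration.span_topologicalClosure (he : P.IsEigenvalueEnumeration e) :
    (Submodule.span ℂ {g : Lp Vec2 2 P.wMeasure |
      ∃ n : ℤ, g =ᵐ[P.wMeasure] P.phi (e n)}).topologicalClosure = ⊤ := by
  rw [eq_top_iff]
  intro g _
  have h := ((WithLp.fstL 2 ℂ (Lp Vec2 2 P.wMeasure) ℂ).continuous.tendsto _).comp
    (he.hasSum_eigvec (WithLp.toLp 2 (g, 0)))
  refine mem_closure_of_tendsto h (Eventually.of_forall fun s => ?_)
  rw [Function.comp_apply, map_sum]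
  refine Submodule.sum_mem _ fun n _ => ?_
  rw [map_smul]
  exact Submodule.smul_mem _ _ (Submodule.subset_span ⟨n, coeFn_embL_toC (P.isAC_phi (e n))⟩)

/-- Elements of the domain of `L` lie in the range of the resolvent. -/
lemma InDomain.exists_isL {Y : (ℝ → Vec2) × ℂ} (hY : P.InDomain Y) : ∃ K, P.IsL Y.1 K := by
  obtain ⟨-, hac, -, hl, h0⟩ := hY
  refine ⟨WithLp.toLp 2 (MemLp.toLp _ hl,
    ((√P.h₂ : ℝ) : ℂ)⁻¹ * (-P.h₁ * Y.1 π 0 - P.h₂ * Y.1 π 1)), hac, h0, ?_, ?_⟩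
  · filter_upwards [hl.coeFn_toLp] with x hx
    exact hx.symm
  · rw [WithLp.toLp_snd, mul_inv_cancel_left₀ P.sqrt_h₂_ne_zero]

/-- Uniform convergence of the expansion of an element of the domain: it is the image of a series
that converges in the Hilbert space under the resolvent, which is continuous into `C[0, π]`. -/
lemma IsEigenvalueEnumeration.tendstoUniformlyOn (he : P.IsEigenvalueEnumeration e)
    {Y : (ℝ → Vec2) × ℂ} (hY : P.InDomain Y) :
    TendstoUniformlyOn (fun (s : Finset ℤ) x => ∑ n ∈ s, P.coeff Y (e n) • P.phi (e n) x)
      Y.1 atTop (Set.Icc 0 π) := by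
  obtain ⟨μ, hμ⟩ := P.exists_real_not_isEigenvalue
  obtain ⟨K, hK⟩ := hY.exists_isL
  set G : P.HSpace := K - (μ : ℂ) • P.embL hK.ac.toC with hG
  have hres : hK.ac.toC = P.resolventL μ G :=
    IsL.toC_eq_resolventL hμ hK.ac (by rwa [hG, add_sub_cancel])
  have hYH : toH hY.1 = P.resolventH μ G := by
    rw [resolventH_apply, ← hres]
    exact toH_of_isAC hK.ac hY.1 rfl hY.2.2.1
  have hterm : ∀ n, P.resolventL μ ((⟪P.eigvec (e n), G⟫_ℂ / ((‖P.eigvec (e n)‖ ^ 2 : ℝ) : ℂ)) •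
      P.eigvec (e n)) = P.coeff Y (e n) • P.phiC (e n) := fun n => by
    have h1 := resolventL_eigvec hμ (he.isEigenvalue n)
    have h2 : ((e n : ℂ) - μ) • P.resolventH μ (P.eigvec (e n)) = P.eigvec (e n) := by
      rw [resolventH_apply, ← map_smul, h1]; rfl
    have h3 : ⟪P.eigvec (e n), G⟫_ℂ = ((e n : ℂ) - μ) * ⟪P.eigvec (e n), toH hY.1⟫_ℂ := by
      conv_lhs => rw [← h2]
      rw [inner_smul_left, map_sub, Complex.conj_ofReal, Complex.conj_ofReal, hYH]
      congr 1
      exact isSymmetric_resolventH hμ _ _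
    rw [map_smul, ← h1, smul_smul, coeff_eq hY.1, h3]
    congr 1
    ring
  have hsum := (he.hasSum_eigvec G).mapL (P.resolventL μ)
  simp only [hterm] at hsum
  rw [← hres] at hsum
  have hu := ContinuousMap.tendsto_iff_tendstoUniformly.1 hsum
  rw [tendstoUniformlyOn_iff_tendstoUniformly_comp_coe]
  intro U hU
  filter_upwards [hu U hU] with s hs x
  have h := hs x
  rw [ContinuousMap.sum_apply] at h
  exact h

end DiracProblem

end Expansion

theorem theorem2 (P : DiracProblem) :
    -- there are eigenvalues `e n`, `n ∈ ℤ`, as the claims below presuppose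
    (∃ e : ℤ → ℝ, P.IsEigenvalueEnumeration e) ∧
    ∀ e : ℤ → ℝ, P.IsEigenvalueEnumeration e →
      -- the eigenfunctions are complete in `L_{2,ρ}(0, π; ℂ²)`
      (Submodule.span ℂ {g : Lp Vec2 2 P.wMeasure |
          ∃ n : ℤ, g =ᵐ[P.wMeasure] P.phi (e n)}).topologicalClosure = ⊤ ∧
      -- uniform convergence of the expansion of an element of `D(L)`
      (∀ Y : (ℝ → Vec2) × ℂ, P.InDomain Y →
        TendstoUniformlyOn
          (fun (s : Finset ℤ) x => ∑ n ∈ s, P.coeff Y (e n) • P.phi (e n) x)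
          Y.1 atTop (Set.Icc 0 π)) ∧
      -- convergence in `L_{2,ρ}` and the Parseval equality;
      -- a function `f ∈ L_{2,ρ}` is the element `(f, 0)` of `H`
      (∀ Y : (ℝ → Vec2) × ℂ, P.MemH Y →
        Tendsto
          (fun s : Finset ℤ => eLpNorm
            (fun x => Y.1 x - ∑ n ∈ s, P.coeff Y (e n) • P.phi (e n) x) 2 P.wMeasure)
          atTop (𝓝 0) ∧
        HasSum (fun n : ℤ => P.normalizing (e n) * ‖P.coeff Y (e n)‖ ^ 2) (P.normSqH Y)) := by
  refine ⟨P.exists_isEigenvalueEnumeration, fun e he => ⟨he.span_topologicalClosure,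
    fun Y hY => he.tendstoUniformlyOn hY, fun Y hY => ⟨he.tendsto_eLpNorm hY, ?_⟩⟩⟩
  simp only [DiracProblem.normalizing_eq, DiracProblem.coeff_eq hY,
    ← DiracProblem.norm_toH_sq hY]
  exact he.hasSum_parseval _
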